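/- Let $n \ge 2$, let $F_n$ be the free group on $x_1,\dots,x_n$, and let $\gamma_1 F_n = F_n$, $\gamma_{k+1}F_n=[\gamma_k F_n,F_n]$. For $k\ge 1$ let $\mathrm{JIA}_n(k)=\ker\big(\mathrm{Aut}(F_n)\to \mathrm{Aut}(F_n/\gamma_{k+1}F_n)\big)$ be the $k$-th term of the Johnson filtration of $\mathrm{IA}_n=\mathrm{JIA}_n(1)$, and let $\mathcal{JL}(k)=\big(\mathrm{JIA}_n(k)/\mathrm{JIA}_n(k+1)\big)\otimes_{\mathbb Z}\mathbb{R}$ be the degree-$k$ part of the associated graded real Lie algebra. Let $\Gamma=\mathrm{SAut}(F_n)$ be the group of automorphisms of $F_n$ acting on $F_n^{\mathrm{ab}}\cong\mathbb{Z}^n$ with determinant $1$; it acts linearly on $\mathcal{JL}(k)$ by conjugation. For $I\subseteq\{1,\dots,n\}$ put $F_I=\langle x_i \mid i\in I\rangle$ and let $\mathrm{Aut}(F_n)_I$ be the subgroup of all $f\in\mathrm{Aut}(F_n)$ with $f(x_i)\in F_I$ for $i\in I$ and $f(x_j)=x_j$ for $j\notin I$. Let $\mathcal{JL}(k)_I$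 be the real subspace of $\mathcal{JL}(k)$ spanned by the image of $\mathrm{JIA}_n(k)\cap \mathrm{Aut}(F_n)_I$. Define $d_\Gamma(\mathcal{JL}(k))$ to be the least integer $d\ge 0$ such that the vector space $\mathcal{JL}(k)$ is spanned by the $\Gamma$-orbits of its subspaces $\mathcal{JL}(k)_I$ with $|I|=d$ (such a $d$ exists, since $d=n$ works). Then $d_\Gamma(\mathcal{JL}(k))\le k+2$ for all $k\ge 1$. -/

import Mathlib

open scoped TensorProduct commutatorElement

/-! ### `[n]`-groups and `[n]`-vector spaces -/

/-- An `[n]`-group structure on `G`: subgroups `G_I` for `I ⊆ [n]`, monotone in `I`, with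
`G_{[n]} = G`. -/
structure NGroup (n : ℕ) (G : Type*) [Group G] where
  sub : Finset (Fin n) → Subgroup G
  mono : ∀ ⦃I J : Finset (Fin n)⦄, I ⊆ J → sub I ≤ sub J
  sub_univ : sub Finset.univ = ⊤

namespace NGroup

/-- The `[n]`-group structure `H_I = H ∩ G_I` on a subgroup `H`. -/
def restrict {n : ℕ} {G : Type*} [Group G] (S : NGroup n G) (H : Subgroup G) : NGroup n H where
  sub I := (S.sub I).subgroupOf H
  mono _ _ hIJ := Subgroup.comap_mono (S.mono hIJ)
  sub_univ := by simp [S.sub_univ]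

/-- The `[n]`-group structure `(G/K)_I = G_I K / K` on a quotient `G/K`. -/
def quotient {n : ℕ} {G : Type*} [Group G] (S : NGroup n G) (K : Subgroup G) [K.Normal] :
    NGroup n (G ⧸ K) where
  sub I := (S.sub I).map (QuotientGroup.mk' K)
  mono _ _ hIJ := Subgroup.map_mono (S.mono hIJ)
  sub_univ := by
    rw [S.sub_univ]
    exact Subgroup.map_top_of_surjective _ (QuotientGroup.mk'_surjective K)

end NGroup

/-- An `[n]`-vector space structure on the real vector space `V`: subspaces `V_I` for `I ⊆ [n]`,
monotone in `I`, with `V_{[n]} = V`. -/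
structure NVectorSpace (n : ℕ) (V : Type*) [AddCommGroup V] [Module ℝ V] where
  sub : Finset (Fin n) → Submodule ℝ V
  mono : ∀ ⦃I J : Finset (Fin n)⦄, I ⊆ J → sub I ≤ sub J
  sub_univ : sub Finset.univ = ⊤

/-- For an abelian `[n]`-group `A` (written multiplicatively), the `[n]`-vector space structure on
`ℝ ⊗ A` in which `(ℝ ⊗ A)_I` is the subspace spanned by the image of `A_I`. -/
def NGroup.realify {n : ℕ} {A : Type*} [CommGroup A] (S : NGroup n A) :
    NVectorSpace n (ℝ ⊗[ℤ] Additive A) where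
  sub I := Submodule.span ℝ
    ((fun a : A => (1 : ℝ) ⊗ₜ[ℤ] Additive.ofMul a) '' (S.sub I : Set A))
  mono _ _ hIJ := Submodule.span_mono (Set.image_mono (S.mono hIJ))
  sub_univ := by
    rw [S.sub_univ, Subgroup.coe_top, Set.image_univ, eq_top_iff]
    intro v _
    induction v using TensorProduct.induction_on with
    | zero => exact Submodule.zero_mem _
    | add x y hx hy => exact Submodule.add_mem _ (hx trivial) (hy trivial)
    | tmul r a =>
      have h : r ⊗ₜ[ℤ] a = r • ((1 : ℝ) ⊗ₜ[ℤ] a) := by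
        rw [TensorProduct.smul_tmul', smul_eq_mul, mul_one]
      rw [h]
      exact Submodule.smul_mem _ _ (Submodule.subset_span ⟨Additive.toMul a, rfl⟩)

namespace NVectorSpace

/-- `V` is generated by the `Γ`-orbits of its subspaces `V_I` with `|I| = d`. -/
def OrbitGenerated {n : ℕ} {V Γ : Type*} [AddCommGroup V] [Module ℝ V] [Group Γ]
    (S : NVectorSpace n V) (ρ : Representation ℝ Γ V) (d : ℕ) : Prop :=
  Submodule.span ℝ
    {w : V | ∃ (γ : Γ) (I : Finset (Fin n)) (v : V), I.card = d ∧ v ∈ S.sub I ∧ w = ρ γ v} = ⊤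

/-- The orbit generation degree `d_Γ(V)`: the least `d ≥ 0` such that `V` is generated by the
`Γ`-orbits of its subspaces `V_I` with `|I| = d`. It takes values in `ℕ∞`, so that a bound on it
always includes the existence of such a `d`. -/
noncomputable def orbitDegree {n : ℕ} {V Γ : Type*} [AddCommGroup V] [Module ℝ V] [Group Γ]
    (S : NVectorSpace n V) (ρ : Representation ℝ Γ V) : ℕ∞ :=
  sInf {e : ℕ∞ | ∃ d : ℕ, e = (d : ℕ∞) ∧ S.OrbitGenerated ρ d}

theorem orbitDegree_le_iff {n : ℕ} {V Γ : Type*} [AddCommGroup V] [Module ℝ V] [Group Γ]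
    (S : NVectorSpace n V) (ρ : Representation ℝ Γ V) (m : ℕ) :
    S.orbitDegree ρ ≤ m ↔ ∃ d : ℕ, d ≤ m ∧ S.OrbitGenerated ρ d := by
  constructor
  · intro h
    have hne : {e : ℕ∞ | ∃ d : ℕ, e = (d : ℕ∞) ∧ S.OrbitGenerated ρ d}.Nonempty := by
      by_contra hne
      rw [Set.not_nonempty_iff_eq_empty] at hne
      rw [orbitDegree, hne, sInf_empty, top_le_iff] at h
      exact ENat.natCast_ne_top m h
    obtain ⟨d, hd, hg⟩ := csInf_mem hne
    refine ⟨d, ?_, hg⟩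
    rw [orbitDegree, hd] at h
    exact_mod_cast h
  · rintro ⟨d, hd, hg⟩
    have h1 : S.orbitDegree ρ ≤ (d : ℕ∞) := sInf_le ⟨d, rfl, hg⟩
    exact h1.trans (by exact_mod_cast hd)

end NVectorSpace

/-! ### The Johnson filtration of the automorphism group of a group -/

/-- `γ_k F = lcs F (k - 1)`, that is `lcs F 0 = F` and `lcs F (k + 1) = [lcs F k, F]`. -/
abbrev lcs (F : Type*) [Group F] (k : ℕ) : Subgroup F := (⊤ : Subgroup F).lowerCentralSeries k

/-- The homomorphism `Aut(F) → Aut(F/N)` for a characteristic subgroup `N`. -/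
def quotAut (F : Type*) [Group F] (N : Subgroup F) [N.Characteristic] :
    MulAut F →* MulAut (F ⧸ N) where
  toFun φ := QuotientGroup.congr N N φ (Subgroup.characteristic_iff_map_eq.mp inferInstance φ)
  map_one' := by
    ext x
    induction x using QuotientGroup.induction_on
    rfl
  map_mul' φ ψ := by
    ext x
    induction x using QuotientGroup.induction_on
    rfl

/-- The `k`-th term of the Johnson filtration of `Aut(F)`: the kernel of
`Aut(F) → Aut(F/γ_{k+1} F)`. For `k = 1` this is the kernel of the action on the abelianization. -/
def johnson (F : Type*) [Group F] (k : ℕ) : Subgroup (MulAut F) := (quotAut F (lcs F k)).ker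

instance johnson_normal (F : Type*) [Group F] (k : ℕ) : (johnson F k).Normal := by
  unfold johnson; infer_instance

theorem mem_johnson_iff {F : Type*} [Group F] {k : ℕ} {φ : MulAut F} :
    φ ∈ johnson F k ↔ ∀ x : F, x⁻¹ * φ x ∈ lcs F k := by
  rw [johnson, MonoidHom.mem_ker]
  constructor
  · intro h x
    have h1 := DFunLike.congr_fun h (QuotientGroup.mk x : F ⧸ lcs F k)
    exact QuotientGroup.eq.mp h1.symm
  · intro h
    ext x
    induction x using QuotientGroup.induction_on with
    | H x => exact (QuotientGroup.eq.mpr (h x)).symm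

theorem johnson_anti {F : Type*} [Group F] {k l : ℕ} (h : k ≤ l) : johnson F l ≤ johnson F k :=
  fun _ hφ => mem_johnson_iff.mpr fun x =>
    Subgroup.lowerCentralSeries_antitone (⊤ : Subgroup F) h (mem_johnson_iff.mp hφ x)

theorem mk_lcs_commute {F : Type*} [Group F] {m : ℕ} {c : F} (hc : c ∈ lcs F m) (x : F) :
    Commute (c : F ⧸ lcs F (m + 1)) (x : F ⧸ lcs F (m + 1)) := by
  rw [← commutatorElement_eq_one_iff_commute]
  have h : ⁅c, x⁆ ∈ lcs F (m + 1) := Subgroup.commutator_mem_commutator hc (Subgroup.mem_top x)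
  exact (QuotientGroup.eq_one_iff _).mpr h

theorem mk_lcs_commute_commutator {F : Type*} [Group F] {m : ℕ} {c d : F} (hc : c ∈ lcs F m)
    (hd : d ∈ lcs F 1) : Commute (d : F ⧸ lcs F (m + 2)) (c : F ⧸ lcs F (m + 2)) := by
  set π := QuotientGroup.mk' (lcs F (m + 2)) with hπ
  have hs : Function.Surjective π := QuotientGroup.mk'_surjective _
  have ht : (⊤ : Subgroup F).map π = ⊤ := Subgroup.map_top_of_surjective _ hs
  have h0 : (lcs F (m + 2)).map π = ⊥ := by
    rw [hπ, Subgroup.map_eq_bot_iff, QuotientGroup.ker_mk']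
  have h2 : ⁅⁅(lcs F m).map π, (⊤ : Subgroup F).map π⁆, (⊤ : Subgroup F).map π⁆ = ⊥ := by
    rw [← Subgroup.map_commutator, ← Subgroup.map_commutator]
    exact h0
  have h1 : ⁅⁅(⊤ : Subgroup F).map π, (lcs F m).map π⁆, (⊤ : Subgroup F).map π⁆ = ⊥ := by
    rw [Subgroup.commutator_comm ((⊤ : Subgroup F).map π)]
    exact h2
  have h3 := Subgroup.commutator_commutator_eq_bot_of_rotate h1 h2
  rw [← Subgroup.map_commutator] at h3
  rw [← commutatorElement_eq_one_iff_commute, ← Subgroup.mem_bot, ← h3]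
  exact Subgroup.commutator_mem_commutator (Subgroup.mem_map_of_mem π hd)
    (Subgroup.mem_map_of_mem π hc)

/-- Automorphisms acting trivially on `F/γ_2 F` act trivially on every `γ_m F/γ_{m+1} F`. -/
theorem mk_apply_eq_of_mem_johnson_one {F : Type*} [Group F] {φ : MulAut F}
    (hφ : φ ∈ johnson F 1) (m : ℕ) {b : F} (hb : b ∈ lcs F m) :
    ((φ b : F) : F ⧸ lcs F (m + 1)) = b := by
  induction m generalizing b with
  | zero => exact (QuotientGroup.eq.mpr (mem_johnson_iff.mp hφ b)).symm
  | succ m ih =>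
    have hle : lcs F (m + 1) ≤ (MonoidHom.eqLocus
        ((QuotientGroup.mk' (lcs F (m + 2))).comp (φ : F ≃* F).toMonoidHom)
        (QuotientGroup.mk' (lcs F (m + 2)))) := by
      refine Subgroup.commutator_le.mpr fun g hg h _ => ?_
      obtain ⟨c, hc, hgc⟩ : ∃ c ∈ lcs F (m + 1), φ g = g * c :=
        ⟨g⁻¹ * φ g, QuotientGroup.eq.mp (ih hg).symm, by group⟩
      obtain ⟨d, hd, hhd⟩ : ∃ d ∈ lcs F 1, φ h = h * d :=
        ⟨h⁻¹ * φ h, mem_johnson_iff.mp hφ h, by group⟩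
      have hcc := fun x : F => (mk_lcs_commute hc x).eq
      have hdg := (mk_lcs_commute_commutator hg hd).eq
      change ((φ ⁅g, h⁆ : F) : F ⧸ lcs F (m + 2)) = ((⁅g, h⁆ : F) : F ⧸ lcs F (m + 2))
      rw [map_commutatorElement, hgc, hhd]
      simp only [commutatorElement_def, QuotientGroup.mk_mul, QuotientGroup.mk_inv, mul_inv_rev]
      have hch := hcc h
      have hcd := hcc d
      generalize (c : F ⧸ lcs F (m + 2)) = C at *
      generalize (d : F ⧸ lcs F (m + 2)) = D at *
      generalize (g : F ⧸ lcs F (m + 2)) = G at *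
      generalize (h : F ⧸ lcs F (m + 2)) = H at *
      calc G * C * (H * D) * (C⁻¹ * G⁻¹) * (D⁻¹ * H⁻¹)
          = G * (C * H) * D * C⁻¹ * G⁻¹ * D⁻¹ * H⁻¹ := by group
        _ = G * H * (C * D) * C⁻¹ * G⁻¹ * D⁻¹ * H⁻¹ := by rw [hch]; group
        _ = G * H * (G⁻¹ * (G * D)) * G⁻¹ * D⁻¹ * H⁻¹ := by rw [hcd]; group
        _ = G * H * G⁻¹ * H⁻¹ := by rw [← hdg]; group
    exact hle hb

theorem johnson_quotient_comm {F : Type*} [Group F] {k : ℕ} (hk : 1 ≤ k)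
    (φ ψ : johnson F k) :
    (φ * ψ)⁻¹ * (ψ * φ) ∈ (johnson F (k + 1)).subgroupOf (johnson F k) := by
  obtain ⟨φ, hφ⟩ := φ
  obtain ⟨ψ, hψ⟩ := ψ
  change (φ * ψ)⁻¹ * (ψ * φ) ∈ johnson F (k + 1)
  have key : quotAut F (lcs F (k + 1)) (φ * ψ) = quotAut F (lcs F (k + 1)) (ψ * φ) := by
    ext x
    induction x using QuotientGroup.induction_on with
    | H x =>
      change ((φ (ψ x) : F) : F ⧸ lcs F (k + 1)) = ((ψ (φ x) : F) : F ⧸ lcs F (k + 1))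
      obtain ⟨a, ha, hxa⟩ : ∃ a ∈ lcs F k, φ x = x * a :=
        ⟨x⁻¹ * φ x, mem_johnson_iff.mp hφ x, by group⟩
      obtain ⟨b, hb, hxb⟩ : ∃ b ∈ lcs F k, ψ x = x * b :=
        ⟨x⁻¹ * ψ x, mem_johnson_iff.mp hψ x, by group⟩
      have h1 := mk_apply_eq_of_mem_johnson_one (johnson_anti hk hφ) k hb
      have h2 := mk_apply_eq_of_mem_johnson_one (johnson_anti hk hψ) k ha
      rw [hxb, map_mul, hxa, map_mul, hxb]
      simp only [QuotientGroup.mk_mul]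
      rw [h1, h2, mul_assoc, mul_assoc, (mk_lcs_commute ha b).eq]
  rw [johnson, MonoidHom.mem_ker, map_mul, map_inv, key, inv_mul_cancel]

/-- The group `G(k)/G(k+1)` for the Johnson filtration `G(k)` of `Aut(F)`, `k ≥ 1`. -/
abbrev JohnsonQuotient (F : Type*) [Group F] (k : ℕ+) : Type _ :=
  johnson F k ⧸ (johnson F ((k : ℕ) + 1)).subgroupOf (johnson F k)

instance (F : Type*) [Group F] (k : ℕ+) : CommGroup (JohnsonQuotient F k) :=
  { (inferInstance : Group (JohnsonQuotient F k)) with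
    mul_comm := by
      intro a b
      induction a using QuotientGroup.induction_on with
      | H a =>
        induction b using QuotientGroup.induction_on with
        | H b => exact QuotientGroup.eq.mpr (johnson_quotient_comm k.pos a b) }

/-- The degree `k` part `(G(k)/G(k+1)) ⊗ ℝ` of the graded real Lie algebra associated to the
Johnson filtration `G(k)` of `Aut(F)`, `k ≥ 1`. -/
abbrev JL (F : Type*) [Group F] (k : ℕ+) : Type _ := ℝ ⊗[ℤ] Additive (JohnsonQuotient F k)

/-- The conjugation action `h ↦ φ h φ⁻¹` of `Aut(F)` on `G(k)/G(k+1)`. -/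
def johnsonConj (F : Type*) [Group F] (k : ℕ+) :
    MulAut F →* Monoid.End (JohnsonQuotient F k) where
  toFun φ := QuotientGroup.map _ _ (MulAut.conjNormal φ : MulAut (johnson F k)).toMonoidHom
    (fun h hh => by
      rw [Subgroup.mem_comap, Subgroup.mem_subgroupOf]
      exact (johnson_normal F ((k : ℕ) + 1)).conj_mem _ hh φ)
  map_one' := by
    ext x
    induction x using QuotientGroup.induction_on with
    | H x =>
      exact congrArg (QuotientGroup.mk : _ → JohnsonQuotient F k)
        (DFunLike.congr_fun (map_one (MulAut.conjNormal (H := johnson F k))) x)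
  map_mul' φ ψ := by
    ext x
    induction x using QuotientGroup.induction_on with
    | H x =>
      exact congrArg (QuotientGroup.mk : _ → JohnsonQuotient F k)
        (DFunLike.congr_fun (map_mul (MulAut.conjNormal (H := johnson F k)) φ ψ) x)

/-- Endomorphisms of an abelian group, as `ℤ`-linear maps. -/
def endToInt (A : Type*) [CommGroup A] : Monoid.End A →* Module.End ℤ (Additive A) where
  toFun f := (MonoidHom.toAdditive f).toIntLinearMap
  map_one' := rfl
  map_mul' _ _ := rfl

/-- The real representation on `ℝ ⊗ A` induced by an action of `Γ` on the abelian group `A`. -/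
noncomputable def realRep {Γ A : Type*} [Group Γ] [CommGroup A] (f : Γ →* Monoid.End A) :
    Representation ℝ Γ (ℝ ⊗[ℤ] Additive A) where
  toFun γ := (endToInt A (f γ)).baseChange ℝ
  map_one' := by
    rw [map_one, map_one]
    exact LinearMap.baseChange_id
  map_mul' φ ψ := by
    rw [map_mul, map_mul]
    exact LinearMap.baseChange_comp _ _

/-! ### Automorphisms of free groups -/

/-- The subgroup `F_I = ⟨x_i | i ∈ I⟩` of the free group `F_n`. -/
def freeSub {n : ℕ} (I : Finset (Fin n)) : Subgroup (FreeGroup (Fin n)) :=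
  Subgroup.closure (FreeGroup.of '' (I : Set (Fin n)))

theorem map_freeSub_eq {n : ℕ} {I : Finset (Fin n)} {f : MulAut (FreeGroup (Fin n))}
    (h1 : ∀ i ∈ I, f (FreeGroup.of i) ∈ freeSub I)
    (h2 : ∀ j, j ∉ I → f (FreeGroup.of j) = FreeGroup.of j) {y : FreeGroup (Fin n)} :
    f y ∈ freeSub I ↔ y ∈ freeSub I := by
  have hf : ∀ z ∈ freeSub I, f z ∈ freeSub I := by
    have : freeSub I ≤ (freeSub I).comap (f : FreeGroup (Fin n) →* FreeGroup (Fin n)) := by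
      refine (Subgroup.closure_le _).mpr ?_
      rintro _ ⟨i, hi, rfl⟩
      exact h1 i hi
    exact this
  refine ⟨fun hy => ?_, hf y⟩
  let r : FreeGroup (Fin n) →* FreeGroup (Fin n) :=
    FreeGroup.lift fun i => if i ∈ I then FreeGroup.of i else 1
  have hr : ∀ z, r z ∈ freeSub I := by
    have : r.range ≤ freeSub I := by
      refine FreeGroup.range_lift_le ?_
      rintro _ ⟨i, rfl⟩
      by_cases hi : i ∈ I
      · have : FreeGroup.of i ∈ freeSub I := Subgroup.subset_closure ⟨i, hi, rfl⟩
        simpa [hi] using this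
      · simp [hi, one_mem]
    exact fun z => this ⟨z, rfl⟩
  have hid : ∀ z ∈ freeSub I, r z = z := by
    have : freeSub I ≤ r.eqLocus (MonoidHom.id _) := by
      refine (Subgroup.closure_le _).mpr ?_
      rintro _ ⟨i, hi, rfl⟩
      have hi' : i ∈ I := hi
      change r (FreeGroup.of i) = FreeGroup.of i
      simp [r, hi']
    exact this
  have hcomm : (f : FreeGroup (Fin n) →* FreeGroup (Fin n)).comp r =
      r.comp (f : FreeGroup (Fin n) →* FreeGroup (Fin n)) := by
    ext i
    change f (r (FreeGroup.of i)) = r (f (FreeGroup.of i))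
    by_cases hi : i ∈ I
    · rw [hid _ (h1 i hi)]
      simp [r, hi]
    · rw [h2 i hi]
      simp [r, hi]
  have h3 : f (r y) = f y := (DFunLike.congr_fun hcomm y).trans (hid _ hy)
  rw [← f.injective h3]
  exact hr y

/-- The `[n]`-group structure on `Aut(F_n)`: `Aut(F_n)_I` consists of the automorphisms that map
`x_i` into `F_I` for `i ∈ I`, and fix `x_j` for `j ∉ I`. -/
def autNGroup (n : ℕ) : NGroup n (MulAut (FreeGroup (Fin n))) where
  sub I :=
    { carrier := {f | (∀ i ∈ I, f (FreeGroup.of i) ∈ freeSub I) ∧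
        ∀ j, j ∉ I → f (FreeGroup.of j) = FreeGroup.of j}
      one_mem' := ⟨fun i hi => Subgroup.subset_closure ⟨i, hi, rfl⟩, fun _ _ => rfl⟩
      mul_mem' := by
        rintro f g ⟨hf1, hf2⟩ ⟨hg1, hg2⟩
        refine ⟨fun i hi => ?_, fun j hj => ?_⟩
        · exact (map_freeSub_eq hf1 hf2).mpr (hg1 i hi)
        · rw [MulAut.mul_apply, hg2 j hj, hf2 j hj]
      inv_mem' := by
        rintro f ⟨hf1, hf2⟩
        refine ⟨fun i hi => ?_, fun j hj => ?_⟩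
        · rw [← map_freeSub_eq hf1 hf2, MulAut.apply_inv_self]
          exact Subgroup.subset_closure ⟨i, hi, rfl⟩
        · rw [← f.injective.eq_iff, MulAut.apply_inv_self, hf2 j hj] }
  mono := by
    rintro I J hIJ f ⟨hf1, hf2⟩
    refine ⟨fun i _ => ?_, fun j hj => hf2 j fun h => hj (hIJ h)⟩
    by_cases hi : i ∈ I
    · exact Subgroup.closure_mono (Set.image_mono (Finset.coe_subset.mpr hIJ)) (hf1 i hi)
    · rw [hf2 i hi]
      exact Subgroup.subset_closure ⟨i, by assumption, rfl⟩
  sub_univ := by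
    rw [eq_top_iff]
    intro f _
    refine ⟨fun i _ => ?_, fun j hj => absurd (Finset.mem_univ j) hj⟩
    have : freeSub (Finset.univ : Finset (Fin n)) = ⊤ := by
      rw [freeSub, Finset.coe_univ, Set.image_univ, FreeGroup.closure_range_of]
    rw [this]
    exact Subgroup.mem_top _

/-- The action of `Aut(F)` on the abelianization of `F`. -/
def abAction (F : Type*) [Group F] : MulAut F →* Module.End ℤ (Additive (Abelianization F)) where
  toFun φ := (MonoidHom.toAdditive (Abelianization.map (φ : F ≃* F).toMonoidHom)).toIntLinearMap
  map_one' := by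
    ext x
    obtain ⟨x, rfl⟩ := QuotientGroup.mk_surjective (Additive.toMul x)
    rfl
  map_mul' φ ψ := by
    ext x
    obtain ⟨x, rfl⟩ := QuotientGroup.mk_surjective (Additive.toMul x)
    rfl

/-- `SAut(F_n)`: the automorphisms of `F_n` that act on `F_n^{ab} ≅ ℤ^n` with determinant `1`. -/
noncomputable def SAut (n : ℕ) : Subgroup (MulAut (FreeGroup (Fin n))) :=
  (LinearMap.det.comp (abAction (FreeGroup (Fin n)))).ker

/-- The conjugation action of `SAut(F_n)` on the degree `k` part of the graded real Lie algebra of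
the Johnson filtration. -/
noncomputable def jlRep (n : ℕ) (k : ℕ+) :
    Representation ℝ (SAut n) (JL (FreeGroup (Fin n)) k) :=
  realRep ((johnsonConj (FreeGroup (Fin n)) k).comp (SAut n).subtype)

/-- The `[n]`-vector space structure on the degree `k` part, induced from the `[n]`-group
structure on `Aut(F_n)` through the subgroup `G(k)` and its quotient `G(k)/G(k+1)`. -/
noncomputable def jlNVectorSpace (n : ℕ) (k : ℕ+) :
    NVectorSpace n (JL (FreeGroup (Fin n)) k) :=
  (((autNGroup n).restrict (johnson (FreeGroup (Fin n)) k)).quotient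
    ((johnson (FreeGroup (Fin n)) ((k : ℕ) + 1)).subgroupOf
      (johnson (FreeGroup (Fin n)) k))).realify

/-!
The proof is by duality. Let `F` be the free group on `x_1, …, x_n`. The Johnson homomorphism
`f ↦ (x_i⁻¹ f(x_i))_i` embeds `johnson F k / johnson F (k + 1)` into
`M = Hom(F^{ab}, lcs F k / lcs F (k + 1))`, so, `ℝ` being divisible, every linear functional on
`JL F k` is the pairing with a family `Φ` of real characters `Φ i` of `lcs F k / lcs F (k + 1)`
(`exists_johnsonPairing_eq`). If `n < k + 2`, take `d = n`. If `n ≥ k + 2`, it has to be shown that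
the functional is zero on `JL F k` once it vanishes on the `SAut(F_n)`-orbits of all `JL(k)_I` with
`|I| = k + 2` (`VanishesOnOrbits.pairing_eq_zero_of_mem_johnson`).

Write `x_i^* ⊗ w` for the element of `M` with `x_i ↦ w` and `x_j ↦ 0` for `j ≠ i`. Modulo the span
of the orbits:

* `x_i^* ⊗ w` is zero if `w` does not involve `x_i`, because `x_i ↦ x_i w` is an automorphism with
  small support;
* `x_i^* ⊗ w`, for a left-normed commutator `w` of generators, is the sum of the terms `x_m^* ⊗ w'`,
  where one occurrence of `x_i` is replaced by a generator `x_m` that does not occur in `w`: apply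
  the transvections `x_i ↦ x_i x_m^c` to `x_m^* ⊗ w` and take the linear coefficient of the
  resulting polynomial in `c` (`VanishesOnOrbits.apply_commWord`);
* hence, by the Jacobi identity, `M` is spanned by the elements
  `s(a) = x_m^* ⊗ [x_m, x_{a_0}, …, x_{a_{k-1}}]`, with `x_m` different from all `x_{a_p}`, and
  `s(a)` does not depend on `m` (`VanishesOnOrbits.eq_zero_of_leftComm`);
* for `k ≥ 2`, `s(a)` is invariant under cyclic rotations of the word `a`, by the commutator of two
  elementary automorphisms (`VanishesOnOrbits.apply_leftComm_rotate`), and for `k = 1`, `s(a)` is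
  zero, because it comes from the conjugation of one generator by another one.

Conversely, for `k ≥ 2`, the cyclic words of length `k` are detected by functionals on `M` that
vanish on the whole Johnson filtration (`exists_divergence`). Fix a cyclic word `b` and a
representation `ρ` of `F` by `k × k` matrices over `ℝ[t]` with `ρ(x_i) = 1 + t Y_i + ⋯`, where `Y_i`
is the sum of the `E_{p+1,p}` with `b_p = i`. It exists, since products of elementary matrices have
polynomial inverses. For an automorphism `f`, the matrix of Fox derivatives `ρ(∂f(x_i)/∂x_j)` is
invertible over `ℝ[t]`, so its determinant is a unit of `ℝ[t]`, that is, a constant. If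
`f ∈ johnson F k`, the coefficient of the determinant at `t^k` is that of
`∑_i tr ρ(∂(x_i⁻¹ f(x_i))/∂x_i)`, so this functional of `f` vanishes. On `s(a)` it is, up to sign,
`tr(Y_{a_{k-1}} ⋯ Y_{a_0})`, the number of rotations of `b` that are equal to `a`.

So a functional that vanishes on the orbits is a function of cyclic words, and a combination of
divergences agrees with it on all `s(a)`. The difference vanishes on the orbits and on all `s(a)`,
hence on `M`, and the divergences vanish on `JL F k`.
-/

/-! ### Commutators in the lower central series -/

theorem lcs_conj_mem {G : Type*} [Group G] {q : ℕ} {u : G} (hu : u ∈ lcs G q) (g : G) :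
    g * u * g⁻¹ ∈ lcs G q :=
  (inferInstance : (lcs G q).Normal).conj_mem u hu g

theorem lcs_succ_le (G : Type*) [Group G] (q : ℕ) : lcs G (q + 1) ≤ lcs G q :=
  Subgroup.lowerCentralSeries_antitone (⊤ : Subgroup G) q.le_succ

theorem mk_conj_of_mem_lcs {G : Type*} [Group G] {q : ℕ} {u : G} (hu : u ∈ lcs G q) (g : G) :
    ((g * u * g⁻¹ : G) : G ⧸ lcs G (q + 1)) = u := by
  rw [QuotientGroup.mk_mul, QuotientGroup.mk_mul, ← (mk_lcs_commute hu g).eq, QuotientGroup.mk_inv,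
    mul_inv_cancel_right]

theorem commutator_mem_lcs_succ {G : Type*} [Group G] {q : ℕ} {u : G} (hu : u ∈ lcs G q) (g : G) :
    ⁅u, g⁆ ∈ lcs G (q + 1) :=
  Subgroup.commutator_mem_commutator hu (Subgroup.mem_top g)

theorem commutator_lcs_le (G : Type*) [Group G] (p q : ℕ) :
    ⁅lcs G p, lcs G q⁆ ≤ lcs G (p + q + 1) := by
  induction q generalizing p with
  | zero => exact le_rfl
  | succ q ih =>
    -- the three subgroups lemma for `lcs G p`, `lcs G q` and `G`, modulo `lcs G (p + q + 2)`
    set K := lcs G (p + (q + 1) + 1) with hK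
    set π := QuotientGroup.mk' K with hπ
    have hbot : ∀ {S : Subgroup G}, S ≤ K → S.map π = ⊥ := fun {S} hS => by
      rwa [Subgroup.map_eq_bot_iff, hπ, QuotientGroup.ker_mk']
    have h1 : ⁅⁅(⊤ : Subgroup G).map π, (lcs G p).map π⁆, (lcs G q).map π⁆ = ⊥ := by
      rw [← Subgroup.map_commutator, ← Subgroup.map_commutator,
        Subgroup.commutator_comm (⊤ : Subgroup G)]
      refine hbot ((ih (p + 1)).trans (le_of_eq ?_))
      rw [hK]; congr 1; omega
    have h2 : ⁅⁅(lcs G p).map π, (lcs G q).map π⁆, (⊤ : Subgroup G).map π⁆ = ⊥ := by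
      rw [← Subgroup.map_commutator, ← Subgroup.map_commutator]
      exact hbot (Subgroup.commutator_mono (ih p) le_rfl)
    have h3 := Subgroup.commutator_commutator_eq_bot_of_rotate h1 h2
    rw [← Subgroup.map_commutator, ← Subgroup.map_commutator, Subgroup.map_eq_bot_iff, hπ,
      QuotientGroup.ker_mk'] at h3
    rw [Subgroup.commutator_comm]
    exact h3

theorem commutator_mem_lcs {G : Type*} [Group G] {p q : ℕ} {x y : G} (hx : x ∈ lcs G p)
    (hy : y ∈ lcs G q) : ⁅x, y⁆ ∈ lcs G (p + q + 1) :=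
  commutator_lcs_le G p q (Subgroup.commutator_mem_commutator hx hy)

/-- The left-normed commutator `[…[[g, a₀], a₁], …, a_{q-1}]`. The entries are taken from an
infinite sequence, of which only the first `q` terms matter. -/
def leftComm {G : Type*} [Group G] (g : G) (a : ℕ → G) : ℕ → G
  | 0 => g
  | q + 1 => ⁅leftComm g a q, a q⁆

theorem leftComm_mem_lcs {G : Type*} [Group G] {p : ℕ} {g : G} (hg : g ∈ lcs G p) (a : ℕ → G)
    (q : ℕ) : leftComm g a q ∈ lcs G (p + q) := by
  induction q with
  | zero => exact hg
  | succ q ih => exact commutator_mem_lcs_succ ih _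

theorem leftComm_mem_lcs_self {G : Type*} [Group G] (g : G) (a : ℕ → G) (q : ℕ) :
    leftComm g a q ∈ lcs G q := by
  have h := leftComm_mem_lcs (p := 0) (Subgroup.mem_top g) a q
  rwa [zero_add] at h

theorem leftComm_congr {G : Type*} [Group G] (g : G) {a b : ℕ → G} {q : ℕ}
    (h : ∀ p < q, a p = b p) : leftComm g a q = leftComm g b q := by
  induction q with
  | zero => rfl
  | succ q ih =>
    rw [leftComm, leftComm, ih fun p hp => h p (hp.trans q.lt_succ_self), h q q.lt_succ_self]

theorem leftComm_succ' {G : Type*} [Group G] (g : G) (a : ℕ → G) (q : ℕ) :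
    leftComm g a (q + 1) = leftComm ⁅g, a 0⁆ (fun p => a (p + 1)) q := by
  induction q with
  | zero => rfl
  | succ q ih => rw [leftComm, ih, leftComm]

theorem map_leftComm {G H : Type*} [Group G] [Group H] (f : G →* H) (g : G) (a : ℕ → G) (q : ℕ) :
    f (leftComm g a q) = leftComm (f g) (fun p => f (a p)) q := by
  induction q with
  | zero => rfl
  | succ q ih => rw [leftComm, leftComm, map_commutatorElement, ih]

theorem leftComm_mem {G : Type*} [Group G] (S : Subgroup G) {g : G} (hg : g ∈ S) {a : ℕ → G} {q : ℕ}
    (ha : ∀ p < q, a p ∈ S) : leftComm g a q ∈ S := by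
  induction q with
  | zero => exact hg
  | succ q ih =>
    have h1 := ih fun p hp => ha p (hp.trans q.lt_succ_self)
    have h2 := ha q q.lt_succ_self
    rw [leftComm, commutatorElement_def]
    exact S.mul_mem (S.mul_mem (S.mul_mem h1 h2) (S.inv_mem h1)) (S.inv_mem h2)

/-! ### Real characters of the graded pieces of the lower central series -/

/-- `φ` restricts to a homomorphism from `lcs G q` to `ℝ` that vanishes on `lcs G (q + 1)`, that
is, to a real character of the graded piece `lcs G q / lcs G (q + 1)`. The values of `φ` outside
`lcs G q` are irrelevant. -/
structure IsGradedChar {G : Type*} [Group G] (q : ℕ) (φ : G → ℝ) : Prop where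
  map_mul : ∀ u ∈ lcs G q, ∀ v ∈ lcs G q, φ (u * v) = φ u + φ v
  eq_zero : ∀ u ∈ lcs G (q + 1), φ u = 0

namespace IsGradedChar

variable {G : Type*} [Group G] {q : ℕ} {φ : G → ℝ}

theorem map_one (h : IsGradedChar q φ) : φ 1 = 0 := h.eq_zero 1 (one_mem _)

theorem map_inv (h : IsGradedChar q φ) {u : G} (hu : u ∈ lcs G q) : φ u⁻¹ = -φ u := by
  have h1 := h.map_mul u hu u⁻¹ (inv_mem hu)
  rw [mul_inv_cancel, h.map_one] at h1
  linarith

theorem congr (h : IsGradedChar q φ) {u v : G} (hu : u ∈ lcs G q)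
    (huv : u⁻¹ * v ∈ lcs G (q + 1)) : φ v = φ u := by
  have h1 := h.map_mul u hu _ (lcs_succ_le G q huv)
  rwa [mul_inv_cancel_left, h.eq_zero _ huv, add_zero] at h1

theorem congr_mk (h : IsGradedChar q φ) {u v : G} (hu : u ∈ lcs G q)
    (huv : (u : G ⧸ lcs G (q + 1)) = v) : φ v = φ u :=
  h.congr hu (QuotientGroup.eq.mp huv)

theorem map_conj (h : IsGradedChar q φ) {u : G} (hu : u ∈ lcs G q) (g : G) :
    φ (g * u * g⁻¹) = φ u :=
  h.congr_mk hu (mk_conj_of_mem_lcs hu g).symm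

theorem map_zpow (h : IsGradedChar q φ) {u : G} (hu : u ∈ lcs G q) (c : ℤ) :
    φ (u ^ c) = c * φ u := by
  have hnat : ∀ m : ℕ, φ (u ^ m) = m * φ u := by
    intro m
    induction m with
    | zero => simp [h.map_one]
    | succ m ih => rw [pow_succ, h.map_mul _ (pow_mem hu m) _ hu, ih]; push_cast; ring
  obtain ⟨m, rfl | rfl⟩ := c.eq_nat_or_neg
  · rw [zpow_natCast, hnat]; simp
  · rw [zpow_neg, zpow_natCast, h.map_inv (pow_mem hu m), hnat]; push_cast; ring

theorem add {ψ : G → ℝ} (h : IsGradedChar q φ) (h' : IsGradedChar q ψ) :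
    IsGradedChar q fun w => φ w + ψ w where
  map_mul u hu v hv := by rw [h.map_mul u hu v hv, h'.map_mul u hu v hv]; ring
  eq_zero u hu := by rw [h.eq_zero u hu, h'.eq_zero u hu, add_zero]

theorem const_mul (h : IsGradedChar q φ) (c : ℝ) : IsGradedChar q fun w => c * φ w where
  map_mul u hu v hv := by rw [h.map_mul u hu v hv]; ring
  eq_zero u hu := by rw [h.eq_zero u hu, mul_zero]

theorem sum {ι : Type*} (s : Finset ι) {φ : ι → G → ℝ} (h : ∀ b, IsGradedChar q (φ b)) :
    IsGradedChar q fun w => ∑ b ∈ s, φ b w where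
  map_mul u hu v hv := by
    rw [← Finset.sum_add_distrib]
    exact Finset.sum_congr rfl fun b _ => (h b).map_mul u hu v hv
  eq_zero u hu := Finset.sum_eq_zero fun b _ => (h b).eq_zero u hu

/-- The commutator induces a biadditive pairing of graded pieces: additivity on the left. -/
theorem comm_left {p : ℕ} (h : IsGradedChar (p + q + 1) φ) {y : G} (hy : y ∈ lcs G q) :
    IsGradedChar p fun x : G => φ ⁅x, y⁆ where
  map_mul u hu v hv := by
    have e : ⁅u * v, y⁆ = u * ⁅v, y⁆ * u⁻¹ * ⁅u, y⁆ := by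
      simp only [commutatorElement_def]; group
    have hv' := commutator_mem_lcs hv hy
    rw [e, h.map_mul _ (lcs_conj_mem hv' u) _ (commutator_mem_lcs hu hy), h.map_conj hv', add_comm]
  eq_zero u hu := h.eq_zero _ (by
    have := commutator_mem_lcs hu hy
    rwa [show p + 1 + q + 1 = p + q + 1 + 1 by omega] at this)

theorem comm_swap {p : ℕ} (h : IsGradedChar (p + q + 1) φ) {x y : G} (hx : x ∈ lcs G p)
    (hy : y ∈ lcs G q) : φ ⁅y, x⁆ = -φ ⁅x, y⁆ := by
  rw [← commutatorElement_inv, h.map_inv (commutator_mem_lcs hx hy)]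

/-- The commutator induces a biadditive pairing of graded pieces: additivity on the right. -/
theorem comm_right {p : ℕ} (h : IsGradedChar (p + q + 1) φ) {x : G} (hx : x ∈ lcs G p) :
    IsGradedChar q fun y : G => φ ⁅x, y⁆ := by
  have h' : IsGradedChar (q + p + 1) φ := by rwa [add_comm q p]
  have h1 := (h'.comm_left hx).const_mul (-1)
  refine ⟨fun u hu v hv => ?_, fun u hu => ?_⟩
  · rw [h'.comm_swap (mul_mem hu hv) hx, h'.comm_swap hu hx, h'.comm_swap hv hx]
    linarith [h1.map_mul u hu v hv]
  · rw [h'.comm_swap (lcs_succ_le G q hu) hx]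
    linarith [h1.eq_zero u hu]

theorem comm_apply (h : IsGradedChar (q + 1) φ) (g : G) : IsGradedChar q fun x : G => φ ⁅x, g⁆ :=
  h.comm_left (q := 0) (Subgroup.mem_top g)

theorem comm_apply_right (h : IsGradedChar (q + 1) φ) {x : G} (hx : x ∈ lcs G q) :
    IsGradedChar 0 fun y : G => φ ⁅x, y⁆ :=
  h.comm_right (q := 0) hx

/-- The Jacobi identity for the graded pieces of the lower central series, a consequence of the
Hall–Witt identity. -/
theorem jacobi {p r : ℕ} (h : IsGradedChar (p + q + r + 2) φ) {x y z : G} (hx : x ∈ lcs G p)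
    (hy : y ∈ lcs G q) (hz : z ∈ lcs G r) :
    φ ⁅x, ⁅y, z⁆⁆ = φ ⁅⁅x, y⁆, z⁆ - φ ⁅⁅x, z⁆, y⁆ := by
  -- signs and membership for a triple commutator, used for its three cyclic rotations below
  have aux : ∀ {i j l : ℕ} {a b c : G}, i + j + l = p + q + r → a ∈ lcs G i → b ∈ lcs G j →
      c ∈ lcs G l → ⁅⁅a⁻¹, b⁆, c⁆ ∈ lcs G (p + q + r + 2) ∧ φ ⁅⁅a⁻¹, b⁆, c⁆ = -φ ⁅⁅a, b⁆, c⁆ ∧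
        φ ⁅⁅b, a⁆, c⁆ = -φ ⁅⁅a, b⁆, c⁆ := by
    intro i j l a b c hs ha hb hc
    have e : i + j + 1 + l + 1 = p + q + r + 2 := by omega
    have h1 : IsGradedChar (i + j + 1 + l + 1) φ := by rwa [e]
    have h2 := h1.comm_left hc
    refine ⟨?_, (h2.comm_left hb).map_inv ha, h2.comm_swap ha hb⟩
    rw [← e]
    exact commutator_mem_lcs (commutator_mem_lcs (inv_mem ha) hb) hc
  obtain ⟨m1, n1, s1⟩ := aux (by omega) hy hx hz
  obtain ⟨m2, n2, s2⟩ := aux (by omega) hz hy hx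
  obtain ⟨m3, n3, -⟩ := aux (by omega) hx hz hy
  have hall : (y * ⁅⁅y⁻¹, x⁆, z⁆ * y⁻¹) * (z * ⁅⁅z⁻¹, y⁆, x⁆ * z⁻¹) *
      (x * ⁅⁅x⁻¹, z⁆, y⁆ * x⁻¹) = 1 := by
    simp only [commutatorElement_def]; group
  have h0 := congrArg φ hall
  rw [h.map_mul _ (mul_mem (lcs_conj_mem m1 y) (lcs_conj_mem m2 z)) _ (lcs_conj_mem m3 x),
    h.map_mul _ (lcs_conj_mem m1 y) _ (lcs_conj_mem m2 z), h.map_conj m1, h.map_conj m2,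
    h.map_conj m3, n1, n2, n3, h.map_one] at h0
  have h' : IsGradedChar ((q + r + 1) + p + 1) φ := by
    rwa [show (q + r + 1) + p + 1 = p + q + r + 2 by omega]
  rw [h'.comm_swap (commutator_mem_lcs hy hz) hx]
  linarith

end IsGradedChar

/-! ### Left-normed commutators of the generators of a free group -/

/-- The left-normed commutator `[…[[x_{a₀}, x_{a₁}], x_{a₂}], …, x_{a_q}]` of generators. -/
def commWord {α : Type*} (a : ℕ → α) (q : ℕ) : FreeGroup α :=
  leftComm (FreeGroup.of (a 0)) (fun p => FreeGroup.of (a (p + 1))) q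

theorem commWord_mem_lcs {α : Type*} (a : ℕ → α) (q : ℕ) : commWord a q ∈ lcs (FreeGroup α) q :=
  leftComm_mem_lcs_self _ _ _

theorem commWord_succ {α : Type*} (a : ℕ → α) (q : ℕ) :
    commWord a (q + 1) = ⁅commWord a q, FreeGroup.of (a (q + 1))⁆ := rfl

theorem commWord_congr {α : Type*} {a b : ℕ → α} {q : ℕ} (h : ∀ p ≤ q, a p = b p) :
    commWord a q = commWord b q := by
  rw [commWord, commWord, h 0 q.zero_le]
  exact leftComm_congr _ fun p hp => by rw [h (p + 1) hp]

theorem commWord_update_succ {α : Type*} (a : ℕ → α) (q : ℕ) (j : α) :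
    commWord (Function.update a (q + 1) j) (q + 1) = ⁅commWord a q, FreeGroup.of j⁆ := by
  rw [commWord_succ, Function.update_self]
  congr 1
  exact commWord_congr fun p hp => Function.update_of_ne (by omega) _ _

theorem commWord_update_of_le {α : Type*} (a : ℕ → α) {p q : ℕ} (hp : p ≤ q) (j : α) :
    commWord (Function.update a p j) (q + 1) =
      ⁅commWord (Function.update a p j) q, FreeGroup.of (a (q + 1))⁆ := by
  rw [commWord_succ, Function.update_of_ne (by omega)]

theorem leftComm_update {α : Type*} (g : FreeGroup α) (a : ℕ → α) (q : ℕ) (j : α) :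
    leftComm g (fun p => FreeGroup.of (Function.update a q j p)) (q + 1) =
      ⁅leftComm g (fun p => FreeGroup.of (a p)) q, FreeGroup.of j⁆ := by
  rw [leftComm, Function.update_self]
  congr 1
  exact leftComm_congr _ fun p hp => by rw [Function.update_of_ne (by omega)]

namespace IsGradedChar

variable {α : Type*} {φ : FreeGroup α → ℝ}

/-- A character of degree `0` is a homomorphism, hence determined on the generators. -/
theorem eq_zero_of_generators (h : IsGradedChar 0 φ) (h0 : ∀ i, φ (FreeGroup.of i) = 0)
    (w : FreeGroup α) : φ w = 0 := by
  induction w using FreeGroup.induction_on with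
  | C1 => exact h.map_one
  | of i => exact h0 i
  | inv_of i _ => rw [h.map_inv (Subgroup.mem_top _), h0, neg_zero]
  | mul u v hu hv => rw [h.map_mul u (Subgroup.mem_top _) v (Subgroup.mem_top _), hu, hv, add_zero]

/-- The graded pieces of the lower central series of a free group are generated by the
left-normed commutators of generators. -/
theorem eq_zero_of_commWord {q : ℕ} (h : IsGradedChar q φ) (h0 : ∀ a, φ (commWord a q) = 0)
    {w : FreeGroup α} (hw : w ∈ lcs (FreeGroup α) q) : φ w = 0 := by
  induction q generalizing φ w with
  | zero => exact h.eq_zero_of_generators (fun i => h0 fun _ => i) w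
  | succ q ih =>
    have key : ∀ u ∈ lcs (FreeGroup α) q, ∀ g : FreeGroup α, φ ⁅u, g⁆ = 0 := by
      intro u hu g
      refine (h.comm_apply_right hu).eq_zero_of_generators (fun j => ?_) g
      refine ih (h.comm_apply (FreeGroup.of j)) (fun a => ?_) hu
      rw [← commWord_update_succ]
      exact h0 _
    -- the kernel of `φ` on `lcs (q + 1)` is a subgroup that contains the generators `[u, g]`
    have hle : lcs (FreeGroup α) (q + 1) ≤
        { carrier := {w | w ∈ lcs (FreeGroup α) (q + 1) ∧ φ w = 0}
          one_mem' := ⟨one_mem _, h.map_one⟩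
          mul_mem' := fun ha hb => ⟨mul_mem ha.1 hb.1, by
            rw [h.map_mul _ ha.1 _ hb.1, ha.2, hb.2, add_zero]⟩
          inv_mem' := fun ha => ⟨inv_mem ha.1, by rw [h.map_inv ha.1, ha.2, neg_zero]⟩ } :=
      Subgroup.commutator_le.mpr fun u hu g _ =>
        ⟨commutator_mem_lcs_succ hu g, key u hu g⟩
    exact (hle hw).2

/-- Bracketing `[x_m, x_{a₁}, …, x_{a_q}]` with a commutator of generators other than `x_m` gives
a combination of such left-normed commutators that start with `x_m`. -/
theorem comm_leftComm_commWord_eq_zero (m : α) (r : ℕ) : ∀ (q : ℕ) (φ : FreeGroup α → ℝ),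
    IsGradedChar (q + r + 1) φ →
    (∀ a : ℕ → α, (∀ p < q + r + 1, a p ≠ m) →
      φ (leftComm (FreeGroup.of m) (fun p => FreeGroup.of (a p)) (q + r + 1)) = 0) →
    ∀ a b : ℕ → α, (∀ p < q, a p ≠ m) → (∀ p ≤ r, b p ≠ m) →
      φ ⁅leftComm (FreeGroup.of m) (fun p => FreeGroup.of (a p)) q, commWord b r⁆ = 0 := by
  have hupd : ∀ {a : ℕ → α} {q : ℕ} {j : α}, (∀ p < q, a p ≠ m) → j ≠ m →
      ∀ p < q + 1, Function.update a q j p ≠ m := by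
    intro a q j ha hj p hp
    rcases eq_or_ne p q with rfl | hne
    · rwa [Function.update_self]
    · rw [Function.update_of_ne hne]; exact ha p (by omega)
  induction r with
  | zero =>
    intro q φ _ h0 a b ha hb
    have := h0 _ (hupd ha (hb 0 le_rfl))
    rwa [add_zero, leftComm_update] at this
  | succ r ih =>
    intro q φ h h0 a b ha hb
    have hbr := hb (r + 1) le_rfl
    have hb' : ∀ p ≤ r, b p ≠ m := fun p hp => hb p (by omega)
    rw [commWord_succ, h.jacobi (p := q) (q := r) (r := 0) (leftComm_mem_lcs_self _ _ _)
      (commWord_mem_lcs _ _) (Subgroup.mem_top _)]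
    have h1 := ih q _ (h.comm_apply (q := q + r + 1) (FreeGroup.of (b (r + 1)))) (fun a' ha' => by
      rw [← leftComm_update]
      exact h0 _ (hupd ha' hbr)) a b ha hb'
    have h2 := ih (q + 1) φ (by rwa [show q + 1 + r + 1 = q + (r + 1) + 1 by omega])
      (by rwa [show q + 1 + r + 1 = q + (r + 1) + 1 by omega])
      (Function.update a q (b (r + 1))) b (hupd ha hbr) hb'
    rw [leftComm_update] at h2
    rw [h1, h2, sub_zero]

/-- A left-normed commutator in which `x_m` occurs exactly once is a combination of left-normed
commutators starting with `x_m`. -/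
theorem commWord_eq_zero_of_occurs_once (m : α) (q : ℕ) : ∀ (φ : FreeGroup α → ℝ),
    IsGradedChar q φ →
    (∀ a : ℕ → α, (∀ p < q, a p ≠ m) →
      φ (leftComm (FreeGroup.of m) (fun p => FreeGroup.of (a p)) q) = 0) →
    ∀ (a : ℕ → α) (p₀ : ℕ), p₀ ≤ q → a p₀ = m → (∀ p ≤ q, p ≠ p₀ → a p ≠ m) →
      φ (commWord a q) = 0 := by
  induction q with
  | zero =>
    intro φ _ h0 a p₀ hp₀ ham _
    obtain rfl : p₀ = 0 := by omega
    have := h0 a (fun p hp => by omega)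
    rwa [leftComm, ← ham] at this
  | succ q ih =>
    intro φ h h0 a p₀ hp₀ ham hne
    rw [commWord_succ]
    rcases Nat.lt_or_ge p₀ (q + 1) with hlt | hge
    · refine ih _ (h.comm_apply (FreeGroup.of (a (q + 1)))) (fun a' ha' => ?_) a p₀ (by omega) ham
        fun p hp => hne p (by omega)
      rw [← leftComm_update]
      refine h0 _ fun p hp => ?_
      rcases eq_or_ne p q with rfl | hpq
      · rw [Function.update_self]; exact hne _ le_rfl (by omega)
      · rw [Function.update_of_ne hpq]; exact ha' p (by omega)
    · obtain rfl : p₀ = q + 1 := by omega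
      have h' : IsGradedChar (0 + q + 1) φ := by rwa [zero_add]
      rw [h'.comm_swap (Subgroup.mem_top _) (commWord_mem_lcs a q), ham]
      have := comm_leftComm_commWord_eq_zero m q 0 φ h' (by rwa [zero_add]) a a
        (fun p hp => by omega) fun p hp => hne p (by omega) (by omega)
      rw [leftComm] at this
      rw [this, neg_zero]

/-- Substituting `x_i x_m^c` for `x_i` in a left-normed commutator and applying a character gives a
polynomial in `c`, whose linear coefficient is the sum over all ways to replace one occurrence of
`x_i` by `x_m`. -/
theorem exists_polynomial_commWord [DecidableEq α] (i m : α) (q : ℕ) : ∀ (φ : FreeGroup α → ℝ),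
    IsGradedChar q φ → ∀ a : ℕ → α, ∃ P : Polynomial ℝ,
      (∀ (c : ℤ) (T : FreeGroup α →* FreeGroup α),
        (∀ j, T (FreeGroup.of j) =
          if j = i then FreeGroup.of i * FreeGroup.of m ^ c else FreeGroup.of j) →
        φ (T (commWord a q)) = P.eval (c : ℝ)) ∧
      P.coeff 0 = φ (commWord a q) ∧
      P.coeff 1 = ∑ p ∈ Finset.range (q + 1),
        if a p = i then φ (commWord (Function.update a p m) q) else 0 := by
  induction q with
  | zero =>
    intro φ h a
    by_cases ha : a 0 = i
    · refine ⟨Polynomial.C (φ (commWord a 0)) +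
        Polynomial.C (φ (FreeGroup.of m)) * Polynomial.X, fun c T hT => ?_, ?_, ?_⟩
      · rw [commWord, leftComm, hT, if_pos ha, h.map_mul _ (Subgroup.mem_top _) _
          (Subgroup.mem_top _), h.map_zpow (Subgroup.mem_top _), ha]
        simp; ring
      · simp
      · simp [ha, commWord, leftComm, Polynomial.coeff_C]
    · refine ⟨Polynomial.C (φ (commWord a 0)), fun c T hT => ?_, ?_, ?_⟩
      · rw [commWord, leftComm, hT, if_neg ha, Polynomial.eval_C]
      · simp
      · simp [ha]
  | succ q ih =>
    intro φ h a
    obtain ⟨P, hP, hP0, hP1⟩ := ih _ (h.comm_apply (FreeGroup.of (a (q + 1)))) a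
    have hsum : ∑ p ∈ Finset.range (q + 1),
        (if a p = i then φ (commWord (Function.update a p m) (q + 1)) else 0) = P.coeff 1 := by
      rw [hP1]
      refine Finset.sum_congr rfl fun p hp => ?_
      rw [commWord_update_of_le a (by simpa [Nat.lt_succ_iff] using hp)]
    by_cases ha : a (q + 1) = i
    · obtain ⟨Q, hQ, hQ0, -⟩ := ih _ (h.comm_apply (FreeGroup.of m)) a
      refine ⟨P + Q * Polynomial.X, fun c T hT => ?_, ?_, ?_⟩
      · have hmem : T (commWord a q) ∈ lcs (FreeGroup α) q := by
          rw [commWord, map_leftComm]; exact leftComm_mem_lcs_self _ _ _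
        have hr := h.comm_apply_right hmem
        rw [commWord_succ, map_commutatorElement, hT (a (q + 1)), if_pos ha,
          hr.map_mul _ (Subgroup.mem_top _) _ (Subgroup.mem_top _),
          hr.map_zpow (Subgroup.mem_top _), hQ c T hT, ← ha, hP c T hT]
        simp; ring
      · simp [hP0, commWord_succ]
      · rw [Finset.sum_range_succ, hsum, if_pos ha, commWord_update_succ]
        simp [hQ0]
    · refine ⟨P, fun c T hT => ?_, ?_, ?_⟩
      · rw [commWord_succ, map_commutatorElement, hT (a (q + 1)), if_neg ha, hP c T hT]
      · rw [hP0, commWord_succ]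
      · rw [Finset.sum_range_succ, hsum, if_neg ha, add_zero]

end IsGradedChar

/-! ### Fox derivatives -/

section Fox

variable {α A : Type*} [Ring A]

/-- `D` is a derivation of the free group with values in `A`, on which the group acts from the
left through `ρ`. -/
def IsFoxDerivation (ρ : FreeGroup α →* Aˣ) (D : FreeGroup α → A) : Prop :=
  ∀ u v, D (u * v) = D u + ρ u * D v

/-- The action of the free group on `A` by affine maps in which the generator `x_i` acts by
`z ↦ ρ(x_i) z + v_i`. -/
def affineAction (ρ : FreeGroup α →* Aˣ) (v : α → A) : FreeGroup α →* Equiv.Perm A :=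
  FreeGroup.lift fun i => (Units.mulLeft (ρ (FreeGroup.of i))).trans (Equiv.addRight (v i))

/-- The derivation of the free group with prescribed values `v i` on the generators: the
translation part of the affine action. -/
def foxDeriv (ρ : FreeGroup α →* Aˣ) (v : α → A) (w : FreeGroup α) : A := affineAction ρ v w 0

theorem affineAction_apply (ρ : FreeGroup α →* Aˣ) (v : α → A) (w : FreeGroup α) :
    ∀ z, affineAction ρ v w z = ρ w * z + foxDeriv ρ v w := by
  unfold foxDeriv
  have inv : ∀ u : FreeGroup α, (∀ z, affineAction ρ v u z = ρ u * z + affineAction ρ v u 0) →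
      ∀ z, affineAction ρ v u⁻¹ z = ρ u⁻¹ * z + affineAction ρ v u⁻¹ 0 := by
    intro u hu z
    have h1 : ∀ z, affineAction ρ v u (affineAction ρ v u⁻¹ z) = z := fun z => by
      rw [← Equiv.Perm.mul_apply, ← map_mul, mul_inv_cancel, map_one, Equiv.Perm.one_apply]
    have h2 : ∀ z, affineAction ρ v u⁻¹ z = ρ u⁻¹ * (z - affineAction ρ v u 0) := fun z => by
      have := h1 z
      rw [hu] at this
      rw [← eq_sub_of_add_eq this, map_inv ρ, Units.inv_mul_cancel_left]
    rw [h2 z, h2 0, zero_sub, mul_sub, mul_neg, sub_eq_add_neg]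
  induction w using FreeGroup.induction_on with
  | C1 => intro z; simp
  | of i => intro z; simp [affineAction]
  | inv_of i h => exact inv _ h
  | mul x y hx hy =>
    intro z
    rw [map_mul, Equiv.Perm.mul_apply, Equiv.Perm.mul_apply, hy z, hx, hx (affineAction ρ v y 0),
      map_mul, Units.val_mul, mul_add, mul_assoc, add_assoc]

theorem foxDeriv_isFoxDerivation (ρ : FreeGroup α →* Aˣ) (v : α → A) :
    IsFoxDerivation ρ (foxDeriv ρ v) := by
  intro x y
  rw [foxDeriv, map_mul, Equiv.Perm.mul_apply, affineAction_apply ρ v x, add_comm]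
  rfl

theorem foxDeriv_of (ρ : FreeGroup α →* Aˣ) (v : α → A) (i : α) :
    foxDeriv ρ v (FreeGroup.of i) = v i := by
  simp [foxDeriv, affineAction]

namespace IsFoxDerivation

variable {ρ : FreeGroup α →* Aˣ} {D : FreeGroup α → A}

theorem map_one (h : IsFoxDerivation ρ D) : D 1 = 0 := by
  simpa using h 1 1

theorem map_inv (h : IsFoxDerivation ρ D) (u : FreeGroup α) : D u⁻¹ = -(ρ u⁻¹ * D u) := by
  have h1 := h u⁻¹ u
  rw [inv_mul_cancel, h.map_one] at h1
  exact eq_neg_of_add_eq_zero_left h1.symm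

theorem map_commutator (h : IsFoxDerivation ρ D) (u v : FreeGroup α) :
    D ⁅u, v⁆ = (1 - ρ (u * v * u⁻¹)) * D u + (ρ u - ρ ⁅u, v⁆) * D v := by
  have e : ∀ x y : FreeGroup α, ((ρ (x * y) : Aˣ) : A) = ρ x * ρ y := fun x y => by simp
  rw [commutatorElement_def, h, h, h, h.map_inv, h.map_inv, sub_mul, sub_mul, one_mul, e _ v⁻¹,
    e _ u⁻¹]
  simp only [mul_neg, mul_assoc]
  abel

theorem ext (h : IsFoxDerivation ρ D) {D' : FreeGroup α → A} (h' : IsFoxDerivation ρ D')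
    (h0 : ∀ i, D (FreeGroup.of i) = D' (FreeGroup.of i)) (w : FreeGroup α) : D w = D' w := by
  induction w using FreeGroup.induction_on with
  | C1 => rw [h.map_one, h'.map_one]
  | of i => exact h0 i
  | inv_of i hi => rw [h.map_inv, h'.map_inv, hi]
  | mul x y hx hy => rw [h, h', hx, hy]

end IsFoxDerivation

/-- The Fox derivative `∂/∂x_j`, pushed forward along `ρ`. -/
def foxPartial [DecidableEq α] (ρ : FreeGroup α →* Aˣ) (j : α) : FreeGroup α → A :=
  foxDeriv ρ (Pi.single j 1)

theorem foxPartial_isFoxDerivation [DecidableEq α] (ρ : FreeGroup α →* Aˣ) (j : α) :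
    IsFoxDerivation ρ (foxPartial ρ j) :=
  foxDeriv_isFoxDerivation _ _

theorem foxPartial_of [DecidableEq α] (ρ : FreeGroup α →* Aˣ) (i j : α) :
    foxPartial ρ j (FreeGroup.of i) = (1 : Matrix α α A) i j := by
  rw [foxPartial, foxDeriv_of, Matrix.one_apply, Pi.single_apply]

/-- The chain rule for Fox derivatives. -/
theorem foxPartial_map [Fintype α] [DecidableEq α] (ρ : FreeGroup α →* Aˣ)
    (f : FreeGroup α →* FreeGroup α) (j : α) (w : FreeGroup α) :
    foxPartial ρ j (f w) =
      ∑ i, foxPartial (ρ.comp f) i w * foxPartial ρ j (f (FreeGroup.of i)) := by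
  have h1 : IsFoxDerivation (ρ.comp f) fun w => foxPartial ρ j (f w) := fun u v => by
    change foxPartial ρ j (f (u * v)) = _
    rw [map_mul, foxPartial_isFoxDerivation]; rfl
  have h2 : IsFoxDerivation (ρ.comp f) fun w =>
      ∑ i, foxPartial (ρ.comp f) i w * foxPartial ρ j (f (FreeGroup.of i)) := fun u v => by
    rw [Finset.mul_sum, ← Finset.sum_add_distrib]
    refine Finset.sum_congr rfl fun i _ => ?_
    rw [foxPartial_isFoxDerivation, add_mul, mul_assoc]
  refine h1.ext h2 (fun l => ?_) w
  simp [foxPartial_of, Matrix.one_apply]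

/-- The Jacobian matrix `(∂ f(x_i) / ∂ x_j)`, pushed forward along `ρ`. -/
def foxJacobian [DecidableEq α] (ρ : FreeGroup α →* Aˣ) (f : FreeGroup α →* FreeGroup α) :
    Matrix α α A :=
  Matrix.of fun i j => foxPartial ρ j (f (FreeGroup.of i))

theorem foxJacobian_mul_foxJacobian [Fintype α] [DecidableEq α] (ρ : FreeGroup α →* Aˣ)
    (f g : FreeGroup α →* FreeGroup α) (hfg : f.comp g = MonoidHom.id _) :
    foxJacobian (ρ.comp f) g * foxJacobian ρ f = 1 := by
  ext l j
  rw [Matrix.mul_apply, ← foxPartial_of ρ l j]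
  have := foxPartial_map ρ f j (g (FreeGroup.of l))
  rw [← MonoidHom.comp_apply, hfg] at this
  exact this.symm

end Fox

/-! ### The divergence of an automorphism in the Johnson filtration -/

section Divergence

open Polynomial Matrix

variable {ι : Type*} [Fintype ι] [DecidableEq ι]

/-- The scalar matrix `t`, where `t` is the polynomial variable. -/
noncomputable abbrev tMat (ι : Type*) [Fintype ι] [DecidableEq ι] : Matrix ι ι ℝ[X] :=
  Matrix.scalar ι (X : ℝ[X])

theorem tMat_pow_mul (q : ℕ) (M : Matrix ι ι ℝ[X]) : tMat ι ^ q * M = (X ^ q : ℝ[X]) • M := by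
  rw [tMat, ← map_pow, Matrix.scalar_apply, Matrix.smul_eq_diagonal_mul]

theorem tMat_pow_mul_comm (q : ℕ) (M : Matrix ι ι ℝ[X]) : tMat ι ^ q * M = M * tMat ι ^ q := by
  rw [tMat, ← map_pow]
  exact (Matrix.scalar_commute _ (fun r => Commute.all _ _) M).eq

theorem dvd_mul_left_tMat {q : ℕ} {M : Matrix ι ι ℝ[X]} (h : tMat ι ^ q ∣ M)
    (N : Matrix ι ι ℝ[X]) : tMat ι ^ q ∣ N * M := by
  obtain ⟨M', rfl⟩ := h
  exact ⟨N * M', by rw [← mul_assoc, ← tMat_pow_mul_comm, mul_assoc]⟩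

theorem mul_dvd_mul_tMat {p q : ℕ} {M N : Matrix ι ι ℝ[X]} (hM : tMat ι ^ p ∣ M)
    (hN : tMat ι ^ q ∣ N) : tMat ι ^ (p + q) ∣ M * N := by
  obtain ⟨M', rfl⟩ := hM
  obtain ⟨N', rfl⟩ := hN
  exact ⟨M' * N', by rw [pow_add, mul_assoc, mul_assoc, ← mul_assoc M', ← tMat_pow_mul_comm,
    mul_assoc]⟩

theorem coeff_trace_eq_zero_of_dvd {q : ℕ} {M : Matrix ι ι ℝ[X]} (h : tMat ι ^ (q + 1) ∣ M) :
    (M.trace).coeff q = 0 := by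
  obtain ⟨M', rfl⟩ := h
  rw [tMat_pow_mul, Matrix.trace_smul, smul_eq_mul, coeff_X_pow_mul', if_neg (by omega)]

variable {α : Type*} {ρ : FreeGroup α →* (Matrix ι ι ℝ[X])ˣ}

/-- If `ρ` is congruent to `1` modulo `t`, then it maps `lcs q` to `1` modulo `t ^ (q + 1)`, and
derivations map `lcs q` to multiples of `t ^ q`. -/
theorem dvd_of_mem_lcs (hρ : ∀ i, tMat ι ∣ ρ (FreeGroup.of i) - 1)
    {D : FreeGroup α → Matrix ι ι ℝ[X]} (hD : IsFoxDerivation ρ D) (q : ℕ) {w : FreeGroup α}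
    (hw : w ∈ lcs (FreeGroup α) q) :
    tMat ι ^ (q + 1) ∣ ρ w - 1 ∧ tMat ι ^ q ∣ D w := by
  have hinv : ∀ (q : ℕ) (u : FreeGroup α), tMat ι ^ q ∣ (ρ u : Matrix ι ι ℝ[X]) - 1 →
      tMat ι ^ q ∣ (ρ u⁻¹ : Matrix ι ι ℝ[X]) - 1 := by
    intro q u hu
    have e : (ρ u⁻¹ : Matrix ι ι ℝ[X]) - 1 = ρ u⁻¹ * -(ρ u - 1) := by
      rw [neg_sub, mul_sub, mul_one, map_inv, Units.inv_mul]
    rw [e]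
    exact dvd_mul_left_tMat (dvd_neg.mpr hu) _
  have hmul : ∀ (q : ℕ) (u v : FreeGroup α), tMat ι ^ q ∣ (ρ u : Matrix ι ι ℝ[X]) - 1 →
      tMat ι ^ q ∣ (ρ v : Matrix ι ι ℝ[X]) - 1 →
      tMat ι ^ q ∣ (ρ (u * v) : Matrix ι ι ℝ[X]) - 1 := by
    intro q u v hu hv
    have e : (ρ (u * v) : Matrix ι ι ℝ[X]) - 1 = ρ u * (ρ v - 1) + (ρ u - 1) := by
      rw [map_mul, Units.val_mul, mul_sub, mul_one, sub_add_sub_cancel]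
    rw [e]
    exact dvd_add (dvd_mul_left_tMat hv _) hu
  have h1 : ∀ u : FreeGroup α, tMat ι ^ 1 ∣ (ρ u : Matrix ι ι ℝ[X]) - 1 := by
    intro u
    induction u using FreeGroup.induction_on with
    | C1 => simp
    | of i => rw [pow_one]; exact hρ i
    | inv_of i hi => exact hinv _ _ hi
    | mul x y hx hy => exact hmul _ _ _ hx hy
  induction q generalizing w with
  | zero => exact ⟨by rw [zero_add]; exact h1 w, by rw [pow_zero]; exact one_dvd _⟩
  | succ q ih =>
    have hle : lcs (FreeGroup α) (q + 1) ≤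
        { carrier := {w | tMat ι ^ (q + 1 + 1) ∣ (ρ w : Matrix ι ι ℝ[X]) - 1 ∧
            tMat ι ^ (q + 1) ∣ D w}
          one_mem' := by simp [hD.map_one]
          mul_mem' := fun {a b} ha hb => ⟨hmul _ _ _ ha.1 hb.1, by
            rw [hD]; exact dvd_add ha.2 (dvd_mul_left_tMat hb.2 _)⟩
          inv_mem' := fun {a} ha => ⟨hinv _ _ ha.1, by
            rw [hD.map_inv]; exact dvd_neg.mpr (dvd_mul_left_tMat ha.2 _)⟩ } := by
      refine Subgroup.commutator_le.mpr fun u hu v _ => ?_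
      obtain ⟨hu1, hu2⟩ := ih hu
      have hc : tMat ι ^ (q + 1 + 1) ∣ (ρ ⁅u, v⁆ : Matrix ι ι ℝ[X]) - 1 := by
        have e : (ρ ⁅u, v⁆ : Matrix ι ι ℝ[X]) - 1 =
            ((ρ u - 1) * (ρ v - 1) - (ρ v - 1) * (ρ u - 1)) * (ρ u⁻¹ * ρ v⁻¹) := by
          have e1 : ((ρ u - 1) * (ρ v - 1) - (ρ v - 1) * (ρ u - 1) : Matrix ι ι ℝ[X]) =
              ρ u * ρ v - ρ v * ρ u := by noncomm_ring
          rw [e1, sub_mul, commutatorElement_def, map_mul, map_mul, map_mul]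
          simp only [Units.val_mul, map_inv, mul_assoc, Units.mul_inv_cancel_left, Units.mul_inv]
        rw [e]
        refine Dvd.dvd.mul_right (dvd_sub (mul_dvd_mul_tMat hu1 (h1 v)) ?_) _
        rw [add_comm (q + 1)]
        exact mul_dvd_mul_tMat (h1 v) hu1
      refine ⟨hc, ?_⟩
      rw [hD.map_commutator]
      refine dvd_add ?_ (Dvd.dvd.mul_right ?_ _)
      · rw [add_comm q]
        refine mul_dvd_mul_tMat ?_ hu2
        rw [← neg_sub]
        exact dvd_neg.mpr (h1 _)
      · have e : (ρ u - ρ ⁅u, v⁆ : Matrix ι ι ℝ[X]) = (ρ u - 1) - (ρ ⁅u, v⁆ - 1) := by abel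
        rw [e]
        exact dvd_sub hu1 ((pow_dvd_pow _ (by omega)).trans hc)
    exact hle hw

theorem isGradedChar_trace (hρ : ∀ i, tMat ι ∣ ρ (FreeGroup.of i) - 1)
    {D : FreeGroup α → Matrix ι ι ℝ[X]} (hD : IsFoxDerivation ρ D) (q : ℕ) :
    IsGradedChar q fun w => ((D w).trace).coeff q where
  map_mul u hu v hv := by
    have e : D (u * v) = D u + D v + (ρ u - 1) * D v := by rw [hD, sub_mul, one_mul]; abel
    have h0 : tMat ι ^ (q + 1) ∣ (ρ u - 1) * D v :=
      Dvd.dvd.mul_right (dvd_of_mem_lcs hρ hD q hu).1 _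
    rw [e, Matrix.trace_add, Matrix.trace_add, coeff_add, coeff_add, coeff_trace_eq_zero_of_dvd h0,
      add_zero]
  eq_zero u hu := coeff_trace_eq_zero_of_dvd (dvd_of_mem_lcs hρ hD (q + 1) hu).2

/-- Automorphisms in the Johnson filtration have divergence zero. The determinant of the Jacobian
matrix is a unit of the polynomial ring, hence constant, and the divergence is its coefficient at
`t ^ k`. -/
theorem sum_trace_foxPartial_eq_zero [Fintype α] [DecidableEq α]
    (hρ : ∀ i, tMat ι ∣ ρ (FreeGroup.of i) - 1) {k : ℕ} (hk : 1 ≤ k) (f : MulAut (FreeGroup α))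
    (hf : ∀ i, (FreeGroup.of i)⁻¹ * f (FreeGroup.of i) ∈ lcs (FreeGroup α) k) :
    ∑ i, ((foxPartial ρ i ((FreeGroup.of i)⁻¹ * f (FreeGroup.of i))).trace).coeff k = 0 := by
  set F : FreeGroup α →* FreeGroup α := (f : FreeGroup α ≃* FreeGroup α).toMonoidHom with hF
  have hD := fun j => foxPartial_isFoxDerivation ρ j
  have hfo : ∀ i j, foxPartial ρ j (F (FreeGroup.of i)) = (1 : Matrix α α (Matrix ι ι ℝ[X])) i j +
      ρ (FreeGroup.of i) * foxPartial ρ j ((FreeGroup.of i)⁻¹ * f (FreeGroup.of i)) := by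
    intro i j
    rw [← foxPartial_of ρ, ← hD j, mul_inv_cancel_left]
    rfl
  have hdvd : ∀ i j, tMat ι ^ k ∣
      ρ (FreeGroup.of i) * foxPartial ρ j ((FreeGroup.of i)⁻¹ * f (FreeGroup.of i)) := fun i j =>
    dvd_mul_left_tMat (dvd_of_mem_lcs hρ (hD j) k (hf i)).2 _
  choose M hM using hdvd
  have hJ : foxJacobian ρ F = 1 + (X ^ k : ℝ[X]) • Matrix.of M := by
    ext1 i j
    rw [foxJacobian, Matrix.of_apply, hfo, hM, tMat_pow_mul]
    rfl
  have hunit : IsUnit (Matrix.compRingEquiv α ι ℝ[X] (foxJacobian ρ F)).det := by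
    have hinv := foxJacobian_mul_foxJacobian ρ F
      ((f⁻¹ : FreeGroup α ≃* FreeGroup α).toMonoidHom) (by ext i; simp [hF])
    have h2 := congrArg (fun Z => (Matrix.compRingEquiv α ι ℝ[X] Z).det) hinv
    simp only [map_mul, map_one, Matrix.det_mul, Matrix.det_one] at h2
    exact IsUnit.of_mul_eq_one_right _ h2
  have hcomp : Matrix.compRingEquiv α ι ℝ[X] (foxJacobian ρ F) =
      1 + (X ^ k : ℝ[X]) • Matrix.compRingEquiv α ι ℝ[X] (Matrix.of M) := by
    rw [hJ, map_add, map_one]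
    rfl
  rw [hcomp, Matrix.det_one_add_smul] at hunit
  obtain ⟨c, -, hc⟩ := Polynomial.isUnit_iff.mp hunit
  have hcoeff := congrArg (fun P : ℝ[X] => P.coeff k) hc
  simp only [coeff_add, coeff_C, coeff_one, ← pow_mul] at hcoeff
  rw [if_neg (by omega), if_neg (by omega), zero_add, coeff_mul_X_pow', coeff_mul_X_pow',
    if_pos le_rfl, if_neg (by omega), add_zero, Nat.sub_self] at hcoeff
  have htr : (Matrix.compRingEquiv α ι ℝ[X] (Matrix.of M)).trace = ∑ i, (M i i).trace := by
    simp only [Matrix.trace, Fintype.sum_prod_type]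
    rfl
  rw [htr, finsetSum_coeff] at hcoeff
  rw [hcoeff]
  refine Finset.sum_congr rfl fun i _ => ?_
  set w := (FreeGroup.of i)⁻¹ * f (FreeGroup.of i) with hw
  have e : foxPartial ρ i w = tMat ι ^ k * M i i - (ρ (FreeGroup.of i) - 1) * foxPartial ρ i w := by
    rw [← hM, sub_mul, one_mul]; abel
  have h0 : tMat ι ^ (k + 1) ∣ (ρ (FreeGroup.of i) - 1) * foxPartial ρ i w := by
    rw [add_comm]
    refine mul_dvd_mul_tMat ?_ (dvd_of_mem_lcs hρ (hD i) k (hf i)).2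
    rw [pow_one]
    exact hρ i
  rw [e, Matrix.trace_sub, coeff_sub, coeff_trace_eq_zero_of_dvd h0, sub_zero, tMat_pow_mul,
    Matrix.trace_smul, smul_eq_mul, coeff_X_pow_mul', if_pos le_rfl, Nat.sub_self]

end Divergence

/-! ### Cyclic words as divergences -/

section CyclicWords

open Polynomial Matrix

variable {α : Type*}

/-- The leading term of `∂[…[[x_l, x_{a₀}], x_{a₁}], …, x_{a_{q-1}}] / ∂x_l`, where
`ρ(x_i) = 1 + t Y_i + ⋯`, is, up to the sign `(-1) ^ q`, the product of the `Y_{a_p}` in reverse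
order. -/
def leadMat {ι : Type*} [Fintype ι] [DecidableEq ι] (Y : α → Matrix ι ι ℝ) (a : ℕ → α) :
    ℕ → Matrix ι ι ℝ
  | 0 => 1
  | q + 1 => -(Y (a q) * leadMat Y a q)

theorem foxPartial_leftComm_sub_dvd {ι : Type*} [Fintype ι] [DecidableEq ι] [DecidableEq α]
    {ρ : FreeGroup α →* (Matrix ι ι ℝ[X])ˣ} {Y : α → Matrix ι ι ℝ}
    (hY : ∀ i, tMat ι ^ 2 ∣ ρ (FreeGroup.of i) - 1 - tMat ι * (Y i).map C) (l : α) (a : ℕ → α)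
    (q : ℕ) (ha : ∀ p < q, a p ≠ l) :
    tMat ι ^ (q + 1) ∣
      foxPartial ρ l (leftComm (FreeGroup.of l) (fun p => FreeGroup.of (a p)) q) -
        tMat ι ^ q * (leadMat Y a q).map C := by
  have hρ : ∀ i, tMat ι ∣ ρ (FreeGroup.of i) - 1 := fun i => by
    have := dvd_add ((dvd_pow_self _ two_ne_zero).trans (hY i)) (Dvd.intro ((Y i).map C) rfl)
    rwa [sub_add_cancel] at this
  have hD := foxPartial_isFoxDerivation ρ l
  induction q with
  | zero => simp [leftComm, leadMat, foxPartial_of]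
  | succ q ih =>
    obtain ⟨E, hE⟩ := ih fun p hp => ha p (by omega)
    set w := leftComm (FreeGroup.of l) (fun p => FreeGroup.of (a p)) q with hw
    set g := FreeGroup.of (a q) with hg
    have hDg : foxPartial ρ l g = 0 := by
      rw [hg, foxPartial_of, Matrix.one_apply_ne (ha q q.lt_succ_self)]
    have hwm : w ∈ lcs (FreeGroup α) q := leftComm_mem_lcs_self _ _ _
    have hc := (dvd_of_mem_lcs hρ hD (q + 1) (commutator_mem_lcs_succ hwm g)).1
    obtain ⟨E', hE'⟩ := hY (a q)
    have e1 : (ρ (w * g * w⁻¹) : Matrix ι ι ℝ[X]) = ρ ⁅w, g⁆ * ρ g := by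
      rw [← Units.val_mul, ← map_mul, commutatorElement_def, inv_mul_cancel_right]
    have e2 : (ρ g : Matrix ι ι ℝ[X]) = 1 + tMat ι * (Y (a q)).map C + tMat ι ^ 2 * E' := by
      rw [← hE']; abel
    have e3 : foxPartial ρ l w = tMat ι ^ q * (leadMat Y a q).map C + tMat ι ^ (q + 1) * E := by
      rw [← hE]; abel
    have e4 : ((leadMat Y a (q + 1)).map C : Matrix ι ι ℝ[X]) =
        -((Y (a q)).map C * (leadMat Y a q).map C) := by
      rw [leadMat, Matrix.map_neg _ (by simp), Matrix.map_mul]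
    have e5 : foxPartial ρ l ⁅w, g⁆ - tMat ι ^ (q + 1) * (leadMat Y a (q + 1)).map C =
        -((ρ ⁅w, g⁆ - 1) * (ρ g * foxPartial ρ l w)) - tMat ι ^ 2 * E' * foxPartial ρ l w -
          tMat ι * (Y (a q)).map C * (tMat ι ^ (q + 1) * E) := by
      rw [hD.map_commutator, hDg, mul_zero, add_zero, e1, e4]
      have e6 : (1 - (ρ ⁅w, g⁆ : Matrix ι ι ℝ[X]) * ρ g) * foxPartial ρ l w =
          -((ρ ⁅w, g⁆ - 1) * (ρ g * foxPartial ρ l w)) - (ρ g - 1) * foxPartial ρ l w := by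
        noncomm_ring
      have e7 : ((ρ g - 1) : Matrix ι ι ℝ[X]) * foxPartial ρ l w =
          tMat ι * (Y (a q)).map C * (tMat ι ^ q * (leadMat Y a q).map C) +
            tMat ι * (Y (a q)).map C * (tMat ι ^ (q + 1) * E) +
            tMat ι ^ 2 * E' * foxPartial ρ l w := by
        rw [e2, ← mul_add, ← e3]; noncomm_ring
      have e8 : tMat ι * (Y (a q)).map C * (tMat ι ^ q * (leadMat Y a q).map C) =
          tMat ι ^ (q + 1) * ((Y (a q)).map C * (leadMat Y a q).map C) := by
        rw [pow_succ', mul_assoc, mul_assoc, ← mul_assoc _ (tMat ι ^ q), ← tMat_pow_mul_comm,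
          mul_assoc]
      rw [e6, e7, e8, mul_neg]
      abel
    have d1 : tMat ι ^ (q + 1 + 1) ∣ (tMat ι ^ 2 * E') * foxPartial ρ l w := by
      have := mul_dvd_mul_tMat (Dvd.intro E' rfl : tMat ι ^ 2 ∣ tMat ι ^ 2 * E')
        (dvd_of_mem_lcs hρ hD q hwm).2
      rwa [show 2 + q = q + 1 + 1 by omega] at this
    have d2 : tMat ι ^ (q + 1 + 1) ∣ tMat ι * (Y (a q)).map C * (tMat ι ^ (q + 1) * E) := by
      have := mul_dvd_mul_tMat (p := 1) (M := tMat ι * (Y (a q)).map C)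
        (by rw [pow_one]; exact Dvd.intro _ rfl)
        (Dvd.intro E rfl : tMat ι ^ (q + 1) ∣ tMat ι ^ (q + 1) * E)
      rwa [add_comm 1] at this
    rw [leftComm, e5]
    exact dvd_sub (dvd_sub (dvd_neg.mpr (Dvd.dvd.mul_right hc _)) d1) d2

variable {k : ℕ} [NeZero k]

/-- The matrix `∑ E_{p+1,p}`, over all `p : ZMod k` with `b p = i`. -/
noncomputable def cyclicMat [DecidableEq α] (b : ZMod k → α) (i : α) :
    Matrix (ZMod k) (ZMod k) ℝ :=
  Matrix.of fun r s => if r = s + 1 ∧ b s = i then 1 else 0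

theorem leadMat_cyclicMat_apply [DecidableEq α] (b : ZMod k → α) (a : ℕ → α) (q : ℕ) :
    ∀ r s, leadMat (cyclicMat b) a q r s =
      (-1) ^ q * if r = s + (q : ZMod k) ∧ ∀ p < q, b (s + (p : ZMod k)) = a p then 1 else 0 := by
  induction q with
  | zero => intro r s; simp [leadMat, Matrix.one_apply]
  | succ q ih =>
    intro r s
    rw [leadMat, Matrix.neg_apply, Matrix.mul_apply, Finset.sum_eq_single (s + (q : ZMod k))]
    · rw [ih, cyclicMat, Matrix.of_apply, pow_succ]
      have e : (∀ p < q + 1, b (s + (p : ZMod k)) = a p) ↔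
          (∀ p < q, b (s + (p : ZMod k)) = a p) ∧ b (s + (q : ZMod k)) = a q := by
        constructor
        · exact fun h => ⟨fun p hp => h p (by omega), h q (by omega)⟩
        · rintro ⟨h1, h2⟩ p hp
          rcases Nat.lt_succ_iff_lt_or_eq.mp hp with h | rfl
          exacts [h1 p h, h2]
      simp only [e, Nat.cast_add, Nat.cast_one, ← add_assoc, true_and]
      by_cases h1 : r = s + (q : ZMod k) + 1 <;> by_cases h2 : b (s + (q : ZMod k)) = a q <;>
        simp only [h1, h2, and_true, and_false, false_and, true_and, if_true, if_false] <;>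
        split_ifs <;> simp
    · intro z _ hz
      rw [ih, if_neg (fun h => hz h.1), mul_zero, mul_zero]
    · exact fun h => absurd (Finset.mem_univ _) h

/-- There is a representation over `ℝ[t]` with `ρ(x_i) = 1 + t Y_i + ⋯`, where `Y_i` is the matrix
`cyclicMat b i`: send `x_i` to a product of elementary matrices. -/
theorem exists_rep_cyclicMat [DecidableEq α] (hk : 2 ≤ k) (b : ZMod k → α) :
    ∃ ρ : FreeGroup α →* (Matrix (ZMod k) (ZMod k) ℝ[X])ˣ, ∀ i,
      tMat (ZMod k) ^ 2 ∣ ρ (FreeGroup.of i) - 1 - tMat (ZMod k) * (cyclicMat b i).map C := by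
  have : Fact (1 < k) := ⟨hk⟩
  let e : α → ZMod k → Matrix (ZMod k) (ZMod k) ℝ := fun i p =>
    Matrix.single (p + 1) p (if b p = i then 1 else 0)
  have hprod : ∀ i (L : List (ZMod k)),
      IsUnit (L.map fun p => 1 + tMat (ZMod k) * (e i p).map C).prod ∧
      tMat (ZMod k) ^ 2 ∣ (L.map fun p => 1 + tMat (ZMod k) * (e i p).map C).prod - 1 -
        tMat (ZMod k) * ((L.map (e i)).sum).map C := by
    intro i L
    induction L with
    | nil => simp
    | cons p L ih =>
      obtain ⟨h1, E, hE⟩ := ih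
      have hu : IsUnit (1 + tMat (ZMod k) * (e i p).map C) := by
        have : 1 + tMat (ZMod k) * (e i p).map C =
            Matrix.transvection (p + 1) p (if b p = i then X else 0 : ℝ[X]) := by
          rw [Matrix.transvection, ← pow_one (tMat (ZMod k)), tMat_pow_mul, pow_one]
          ext r s
          by_cases hb : b p = i <;> simp [e, hb, Matrix.single_apply]
        rw [this, Matrix.isUnit_iff_isUnit_det, Matrix.det_transvection_of_ne _ _ (by simp)]
        exact isUnit_one
      rw [List.map_cons, List.prod_cons, List.map_cons, List.sum_cons]
      refine ⟨hu.mul h1, ?_⟩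
      have e1 : (L.map fun p => 1 + tMat (ZMod k) * (e i p).map C).prod =
          1 + tMat (ZMod k) * ((L.map (e i)).sum).map C + tMat (ZMod k) ^ 2 * E := by
        rw [← hE]; abel
      have e2 : ((e i p + (L.map (e i)).sum).map C : Matrix (ZMod k) (ZMod k) ℝ[X]) =
          (e i p).map C + ((L.map (e i)).sum).map C := Matrix.map_add _ (by simp) _ _
      rw [e2, e1]
      have e3 : ∀ A B T Q : Matrix (ZMod k) (ZMod k) ℝ[X],
          (1 + T * A) * (1 + T * B + Q) - 1 - T * (A + B) =
            (T * A) * (T * B) + (1 + T * A) * Q := by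
        intro A B T Q
        simp only [mul_add, add_mul, one_mul, mul_one]
        abel
      rw [e3]
      have h1 : ∀ A : Matrix (ZMod k) (ZMod k) ℝ[X], tMat (ZMod k) ^ 1 ∣ tMat (ZMod k) * A :=
        fun A => by rw [pow_one]; exact Dvd.intro _ rfl
      refine dvd_add ?_ (dvd_mul_left_tMat (Dvd.intro E rfl) _)
      rw [← one_add_one_eq_two]
      exact mul_dvd_mul_tMat (h1 _) (h1 _)
  refine ⟨FreeGroup.lift fun i => (hprod i Finset.univ.toList).1.unit, fun i => ?_⟩
  have h2 : (Finset.univ.toList.map (e i)).sum = cyclicMat b i := by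
    rw [Finset.sum_map_toList]
    ext r s
    rw [Matrix.sum_apply, Finset.sum_eq_single s]
    · rcases eq_or_ne r (s + 1) with rfl | hr
      · simp [cyclicMat]
      · simp [cyclicMat, hr, hr.symm]
    · intro p _ hp
      simp [hp]
    · exact fun h => absurd (Finset.mem_univ _) h
  rw [← h2, FreeGroup.lift_apply_of]
  exact (hprod i Finset.univ.toList).2

/-- The divergence functionals: for each word `b`, read cyclically, there are characters `λ_i` of
degree `k` such that `∑ λ_i(x_i⁻¹ f(x_i))` vanishes for `f` in the Johnson filtration, while
`λ_l` counts, up to sign, the rotations of `b` that are equal to `a` when applied to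
`[…[[x_l, x_{a₀}], x_{a₁}], …, x_{a_{k-1}}]`. -/
theorem exists_divergence [Fintype α] [DecidableEq α] (hk : 2 ≤ k) (b : ZMod k → α) :
    ∃ φ : α → FreeGroup α → ℝ, (∀ i, IsGradedChar k (φ i)) ∧
      (∀ f : MulAut (FreeGroup α),
        (∀ i, (FreeGroup.of i)⁻¹ * f (FreeGroup.of i) ∈ lcs (FreeGroup α) k) →
        ∑ i, φ i ((FreeGroup.of i)⁻¹ * f (FreeGroup.of i)) = 0) ∧
      ∀ (l : α) (a : ℕ → α), (∀ p < k, a p ≠ l) →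
        φ l (leftComm (FreeGroup.of l) (fun p => FreeGroup.of (a p)) k) =
          (-1) ^ k * ∑ s : ZMod k, if ∀ p < k, b (s + (p : ZMod k)) = a p then 1 else 0 := by
  obtain ⟨ρ, hY⟩ := exists_rep_cyclicMat hk b
  have hρ : ∀ i, tMat (ZMod k) ∣ ρ (FreeGroup.of i) - 1 := fun i => by
    have := dvd_add ((dvd_pow_self _ two_ne_zero).trans (hY i))
      (Dvd.intro ((cyclicMat b i).map C) rfl)
    rwa [sub_add_cancel] at this
  refine ⟨fun i w => ((foxPartial ρ i w).trace).coeff k,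
    fun i => isGradedChar_trace hρ (foxPartial_isFoxDerivation ρ i) k,
    fun f hf => sum_trace_foxPartial_eq_zero hρ (by omega) f hf, fun l a ha => ?_⟩
  have h := coeff_trace_eq_zero_of_dvd (foxPartial_leftComm_sub_dvd hY l a k ha)
  rw [Matrix.trace_sub, coeff_sub, sub_eq_zero] at h
  refine h.trans ?_
  rw [tMat_pow_mul, Matrix.trace_smul, smul_eq_mul, coeff_X_pow_mul', if_pos le_rfl,
    Nat.sub_self, Matrix.trace, finsetSum_coeff, Finset.mul_sum]
  refine Finset.sum_congr rfl fun s _ => ?_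
  rw [Matrix.diag_apply, Matrix.map_apply, coeff_C_zero, leadMat_cyclicMat_apply]
  simp

end CyclicWords

/-! ### Elementary automorphisms of free groups -/

theorem of_mem_freeSub {n : ℕ} {I : Finset (Fin n)} {i : Fin n} (hi : i ∈ I) :
    FreeGroup.of i ∈ freeSub I :=
  Subgroup.subset_closure ⟨i, hi, rfl⟩

theorem freeSub_mono {n : ℕ} {I J : Finset (Fin n)} (h : I ⊆ J) : freeSub I ≤ freeSub J :=
  Subgroup.closure_mono (Set.image_mono (Finset.coe_subset.mpr h))

theorem hom_apply_of_mem_freeSub {n : ℕ} {I : Finset (Fin n)}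
    {f : FreeGroup (Fin n) →* FreeGroup (Fin n)} (hf : ∀ i ∈ I, f (FreeGroup.of i) = FreeGroup.of i)
    {w : FreeGroup (Fin n)} (hw : w ∈ freeSub I) : f w = w := by
  have : freeSub I ≤ f.eqLocus (MonoidHom.id _) := by
    refine (Subgroup.closure_le _).mpr ?_
    rintro _ ⟨i, hi, rfl⟩
    exact hf i hi
  exact this hw

/-- The endomorphism `x_i ↦ u x_i v` that fixes the other generators. -/
def elemHom {n : ℕ} (i : Fin n) (u v : FreeGroup (Fin n)) :
    FreeGroup (Fin n) →* FreeGroup (Fin n) :=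
  FreeGroup.lift (Function.update FreeGroup.of i (u * FreeGroup.of i * v))

theorem elemHom_of_self {n : ℕ} (i : Fin n) (u v : FreeGroup (Fin n)) :
    elemHom i u v (FreeGroup.of i) = u * FreeGroup.of i * v := by
  simp [elemHom]

theorem elemHom_of_ne {n : ℕ} {i j : Fin n} (h : j ≠ i) (u v : FreeGroup (Fin n)) :
    elemHom i u v (FreeGroup.of j) = FreeGroup.of j := by
  simp [elemHom, h]

theorem elemHom_apply_of_mem {n : ℕ} {i : Fin n} (u v : FreeGroup (Fin n)) {w : FreeGroup (Fin n)}
    {J : Finset (Fin n)} (hiJ : i ∉ J) (hw : w ∈ freeSub J) : elemHom i u v w = w :=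
  hom_apply_of_mem_freeSub (fun j hj => elemHom_of_ne (fun h : j = i => hiJ (h ▸ hj)) u v) hw

theorem elemHom_comp_inv {n : ℕ} {i : Fin n} {u v : FreeGroup (Fin n)} {J : Finset (Fin n)}
    (hiJ : i ∉ J) (hu : u ∈ freeSub J) (hv : v ∈ freeSub J) :
    (elemHom i u v).comp (elemHom i u⁻¹ v⁻¹) = MonoidHom.id _ := by
  ext j
  rw [MonoidHom.comp_apply, MonoidHom.id_apply]
  rcases eq_or_ne j i with rfl | h
  · rw [elemHom_of_self, map_mul, map_mul, elemHom_of_self,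
      elemHom_apply_of_mem u v hiJ (inv_mem hu), elemHom_apply_of_mem u v hiJ (inv_mem hv)]
    group
  · rw [elemHom_of_ne h, elemHom_of_ne h]

/-- The automorphism `x_i ↦ u x_i v` that fixes the other generators, where `u` and `v` do not
involve `x_i`. -/
def elemAut {n : ℕ} (i : Fin n) (u v : FreeGroup (Fin n)) {J : Finset (Fin n)} (hiJ : i ∉ J)
    (hu : u ∈ freeSub J) (hv : v ∈ freeSub J) : MulAut (FreeGroup (Fin n)) :=
  MonoidHom.toMulEquiv (elemHom i u v) (elemHom i u⁻¹ v⁻¹)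
    (by simpa using elemHom_comp_inv hiJ (inv_mem hu) (inv_mem hv))
    (elemHom_comp_inv hiJ hu hv)

section elemAut

variable {n : ℕ} {i : Fin n} {u v : FreeGroup (Fin n)} {J : Finset (Fin n)} (hiJ : i ∉ J)
    (hu : u ∈ freeSub J) (hv : v ∈ freeSub J)

theorem elemAut_of_self :
    elemAut i u v hiJ hu hv (FreeGroup.of i) = u * FreeGroup.of i * v := elemHom_of_self i u v

theorem elemAut_of_ne {j : Fin n} (h : j ≠ i) :
    elemAut i u v hiJ hu hv (FreeGroup.of j) = FreeGroup.of j := elemHom_of_ne h u v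

theorem elemAut_apply_of_mem {w : FreeGroup (Fin n)} (hw : w ∈ freeSub J) :
    elemAut i u v hiJ hu hv w = w := elemHom_apply_of_mem u v hiJ hw

theorem elemAut_mem_sub {I : Finset (Fin n)} (hi : i ∈ I) (hJI : J ⊆ I) :
    elemAut i u v hiJ hu hv ∈ (autNGroup n).sub I := by
  refine ⟨fun j hj => ?_, fun j hj => elemAut_of_ne hiJ hu hv fun h => hj (h ▸ hi)⟩
  rcases eq_or_ne j i with rfl | h
  · rw [elemAut_of_self]
    exact mul_mem (mul_mem (freeSub_mono hJI hu) (of_mem_freeSub hi)) (freeSub_mono hJI hv)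
  · rw [elemAut_of_ne hiJ hu hv h]
    exact of_mem_freeSub hj

end elemAut

theorem commWord_mem_freeSub {n : ℕ} (a : ℕ → Fin n) (q : ℕ) :
    commWord a q ∈ freeSub ((Finset.range (q + 1)).image a) :=
  leftComm_mem _ (of_mem_freeSub (Finset.mem_image_of_mem a (by simp))) fun p hp =>
    of_mem_freeSub (Finset.mem_image_of_mem a (by simpa using hp))

theorem mul_self_mem_SAut {n : ℕ} (f : MulAut (FreeGroup (Fin n))) : f * f ∈ SAut n := by
  rw [SAut, MonoidHom.mem_ker, map_mul]
  have h : IsUnit ((LinearMap.det.comp (abAction (FreeGroup (Fin n)))) f) :=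
    (Group.isUnit f).map _
  exact Int.isUnit_mul_self h

/-! ### Membership in the Johnson filtration -/

theorem mem_johnson_of_generators {α : Type*} {k : ℕ} {f : MulAut (FreeGroup α)}
    (h : ∀ i, (FreeGroup.of i)⁻¹ * f (FreeGroup.of i) ∈ lcs (FreeGroup α) k) :
    f ∈ johnson (FreeGroup α) k := by
  rw [mem_johnson_iff]
  have e : (QuotientGroup.mk' (lcs (FreeGroup α) k)).comp (f : FreeGroup α ≃* _).toMonoidHom =
      QuotientGroup.mk' (lcs (FreeGroup α) k) := by
    ext i
    exact (QuotientGroup.eq.mpr (h i)).symm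
  exact fun x => QuotientGroup.eq.mp (DFunLike.congr_fun e x).symm

theorem map_mem_lcs {G : Type*} [Group G] (f : G →* G) {q : ℕ} {w : G} (hw : w ∈ lcs G q) :
    f w ∈ lcs G q := by
  have h := Subgroup.mem_map_of_mem f hw
  rw [Subgroup.map_lowerCentralSeries] at h
  exact Subgroup.lowerCentralSeries_mono q le_top h

theorem elemAut_mem_johnson {n k : ℕ} {i : Fin n} {w : FreeGroup (Fin n)} {J : Finset (Fin n)}
    (hiJ : i ∉ J) (hw : w ∈ freeSub J) (hwk : w ∈ lcs (FreeGroup (Fin n)) k) :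
    elemAut i 1 w hiJ (one_mem _) hw ∈ johnson (FreeGroup (Fin n)) k := by
  refine mem_johnson_of_generators fun j => ?_
  rcases eq_or_ne j i with rfl | hj
  · rwa [elemAut_of_self, one_mul, inv_mul_cancel_left]
  · rw [elemAut_of_ne _ _ _ hj, inv_mul_cancel]
    exact one_mem _

/-! ### Functionals that vanish on the orbits of automorphisms with small support -/

/-- The pairing of a family `Φ` of characters of degree `k` with `f ∈ johnson F k`. Such families
are the linear functionals on the target `Hom(F^{ab}, lcs F k / lcs F (k + 1)) ⊗ ℝ` of the Johnson
homomorphism; `Φ i w` is the value at the element `x_i^* ⊗ w` that maps `x_i` to `w` and the other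
generators to `0`. -/
def johnsonPairing {n : ℕ} (Φ : Fin n → FreeGroup (Fin n) → ℝ) (f : MulAut (FreeGroup (Fin n))) :
    ℝ :=
  ∑ i, Φ i ((FreeGroup.of i)⁻¹ * f (FreeGroup.of i))

/-- The functional given by the characters `Φ i` of degree `k` vanishes on the `SAut(F_n)`-orbits of
all subspaces `JL(k)_I` with `|I| = k + 2`. -/
structure VanishesOnOrbits {n : ℕ} (k : ℕ) (Φ : Fin n → FreeGroup (Fin n) → ℝ) : Prop where
  char : ∀ i, IsGradedChar k (Φ i)
  pairing : ∀ γ ∈ SAut n, ∀ (I : Finset (Fin n)), I.card = k + 2 →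
    ∀ f ∈ johnson (FreeGroup (Fin n)) k, f ∈ (autNGroup n).sub I →
    johnsonPairing Φ (γ * f * γ⁻¹) = 0

namespace VanishesOnOrbits

variable {n k : ℕ} {Φ : Fin n → FreeGroup (Fin n) → ℝ}

theorem pairing_conj (h : VanishesOnOrbits k Φ) (hn : k + 2 ≤ n) {γ : MulAut (FreeGroup (Fin n))}
    (hγ : γ ∈ SAut n) {J : Finset (Fin n)} (hJ : J.card ≤ k + 2) {f : MulAut (FreeGroup (Fin n))}
    (hf : f ∈ johnson (FreeGroup (Fin n)) k) (hfJ : f ∈ (autNGroup n).sub J) :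
    johnsonPairing Φ (γ * f * γ⁻¹) = 0 := by
  obtain ⟨I, hJI, -, hI⟩ := Finset.exists_subsuperset_card_eq (Finset.subset_univ J) hJ
    (by simpa using hn)
  exact h.pairing γ hγ I hI f hf ((autNGroup n).mono hJI hfJ)

theorem pairing_eq_zero (h : VanishesOnOrbits k Φ) (hn : k + 2 ≤ n) {J : Finset (Fin n)}
    (hJ : J.card ≤ k + 2) {f : MulAut (FreeGroup (Fin n))}
    (hf : f ∈ johnson (FreeGroup (Fin n)) k) (hfJ : f ∈ (autNGroup n).sub J) :
    johnsonPairing Φ f = 0 := by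
  have := h.pairing_conj hn (one_mem (SAut n)) hJ hf hfJ
  rwa [one_mul, inv_one, mul_one] at this

/-- The functional vanishes on `x_i^* ⊗ w` if `w` does not involve `x_i`. -/
theorem apply_eq_zero (h : VanishesOnOrbits k Φ) (hn : k + 2 ≤ n) {i : Fin n}
    {w : FreeGroup (Fin n)} {J : Finset (Fin n)} (hiJ : i ∉ J) (hJ : J.card ≤ k + 1)
    (hw : w ∈ freeSub J) (hwk : w ∈ lcs (FreeGroup (Fin n)) k) : Φ i w = 0 := by
  have := h.pairing_eq_zero hn ((Finset.card_insert_le i J).trans (by omega))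
    (elemAut_mem_johnson hiJ hw hwk)
    (elemAut_mem_sub hiJ _ hw (Finset.mem_insert_self i J) (Finset.subset_insert i J))
  rw [johnsonPairing, Finset.sum_eq_single i] at this
  · rwa [elemAut_of_self, one_mul, inv_mul_cancel_left] at this
  · intro j _ hj
    rw [elemAut_of_ne _ _ _ hj, inv_mul_cancel, (h.char j).map_one]
  · exact fun hi => absurd (Finset.mem_univ i) hi

/-- The functional takes the same value on `x_m^* ⊗ T(w)` and `x_i^* ⊗ c T(w)`, where `T` is the
transvection `x_i ↦ x_i x_m^c` with `c` even: the difference is the image of `x_m^* ⊗ w` under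
`T`. -/
theorem apply_transvection (h : VanishesOnOrbits k Φ) (hn : k + 2 ≤ n) {i m : Fin n} (him : i ≠ m)
    {w : FreeGroup (Fin n)} {J : Finset (Fin n)} (hmJ : m ∉ J) (hJ : J.card ≤ k + 1)
    (hw : w ∈ freeSub J) (hwk : w ∈ lcs (FreeGroup (Fin n)) k) (d : ℤ) :
    Φ m (elemHom i 1 (FreeGroup.of m ^ (2 * d)) w) =
      (2 * d : ℤ) * Φ i (elemHom i 1 (FreeGroup.of m ^ (2 * d)) w) := by
  set x := FreeGroup.of m with hx
  have hxm : ∀ c : ℤ, x ^ c ∈ freeSub {m} := fun c => zpow_mem (of_mem_freeSub (by simp)) c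
  have him' : i ∉ ({m} : Finset (Fin n)) := by simpa using him
  set T := elemAut i 1 (x ^ (2 * d)) him' (one_mem _) (hxm _) with hT
  set f := elemAut m 1 w hmJ (one_mem _) hw with hf
  -- `T` lies in `SAut` because it is the square of `x_i ↦ x_i x_m^d`
  have hTS : T ∈ SAut n := by
    have : T = elemAut i 1 (x ^ d) him' (one_mem _) (hxm _) *
        elemAut i 1 (x ^ d) him' (one_mem _) (hxm _) := by
      refine MulEquiv.toMonoidHom_injective (FreeGroup.ext_hom _ _ fun j => ?_)
      change T (FreeGroup.of j) = elemAut i 1 (x ^ d) him' (one_mem _) (hxm _)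
        (elemAut i 1 (x ^ d) him' (one_mem _) (hxm _) (FreeGroup.of j))
      rcases eq_or_ne j i with rfl | hj
      · rw [hT, elemAut_of_self, elemAut_of_self, map_mul, map_mul, elemAut_of_self, map_one,
          elemAut_apply_of_mem _ _ _ (hxm d), two_mul, zpow_add]
        simp only [one_mul, mul_assoc]
      · rw [hT, elemAut_of_ne _ _ _ hj, elemAut_of_ne _ _ _ hj, elemAut_of_ne _ _ _ hj]
    rw [this]
    exact mul_self_mem_SAut _
  have h0 := h.pairing_conj hn hTS ((Finset.card_insert_le m J).trans (by omega))
    (elemAut_mem_johnson hmJ hw hwk)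
    (elemAut_mem_sub hmJ (one_mem _) hw (Finset.mem_insert_self m J) (Finset.subset_insert m J))
  have hTinv : ∀ y z, T y = z → T⁻¹ z = y := fun y z hyz => by
    rw [← hyz, MulAut.inv_apply_self]
  have hTm : T x = x := elemAut_of_ne _ _ _ him.symm
  have hTi : T⁻¹ (FreeGroup.of i) = FreeGroup.of i * x ^ (-(2 * d)) := hTinv _ _ (by
    rw [map_mul, map_zpow, hTm, hT, elemAut_of_self, one_mul, mul_assoc, ← zpow_add,
      add_neg_cancel, zpow_zero, mul_one])
  have hTw : T w ∈ lcs (FreeGroup (Fin n)) k := map_mem_lcs T.toMonoidHom hwk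
  have hval_m : x⁻¹ * (T * f * T⁻¹) x = T w := by
    rw [MulAut.mul_apply, MulAut.mul_apply, hTinv _ _ hTm, hf, hx, elemAut_of_self, one_mul,
      map_mul, ← hx, hTm, inv_mul_cancel_left]
  have hval_i : (FreeGroup.of i)⁻¹ * (T * f * T⁻¹) (FreeGroup.of i) =
      x ^ (2 * d) * (x * T w) ^ (-(2 * d)) := by
    have hfi : f (FreeGroup.of i) = FreeGroup.of i := elemAut_of_ne _ _ _ him
    have hfx : f x = x * w := by rw [hf, hx, elemAut_of_self, one_mul]
    rw [MulAut.mul_apply, MulAut.mul_apply, hTi, map_mul, map_zpow, hfi, hfx, map_mul, map_zpow,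
      map_mul, hTm]
    conv_lhs => rw [hT, elemAut_of_self, one_mul]
    rw [mul_assoc, inv_mul_cancel_left]
  have hmk : ((T w ^ (-(2 * d)) : FreeGroup (Fin n)) : _ ⧸ lcs (FreeGroup (Fin n)) (k + 1)) =
      ((x ^ (2 * d) * (x * T w) ^ (-(2 * d)) : FreeGroup (Fin n)) : _ ⧸ _) := by
    have hc := (mk_lcs_commute hTw x).symm
    rw [QuotientGroup.mk_mul, QuotientGroup.mk_zpow, QuotientGroup.mk_zpow, QuotientGroup.mk_zpow,
      QuotientGroup.mk_mul, hc.mul_zpow, ← mul_assoc, ← zpow_add, add_neg_cancel, zpow_zero,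
      one_mul]
  rw [johnsonPairing, Fintype.sum_eq_add i m him] at h0
  · rw [hval_i, hval_m, (h.char i).congr_mk (zpow_mem hTw _) hmk, (h.char i).map_zpow hTw] at h0
    change Φ m (T w) = (2 * d : ℤ) * Φ i (T w)
    push_cast at h0 ⊢
    linarith
  · rintro j ⟨hji, hjm⟩
    have hTj : T (FreeGroup.of j) = FreeGroup.of j := elemAut_of_ne _ _ _ hji
    have hfj : f (FreeGroup.of j) = FreeGroup.of j := elemAut_of_ne _ _ _ hjm
    rw [MulAut.mul_apply, MulAut.mul_apply, hTinv _ _ hTj, hfj, hTj, inv_mul_cancel,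
      (h.char j).map_one]

/-- Modulo the orbits, `x_i^* ⊗ w` is the sum of the terms `x_m^* ⊗ w'`, where `w'` arises from
the left-normed commutator `w` by replacing one occurrence of `x_i` by `x_m`. -/
theorem apply_commWord (h : VanishesOnOrbits k Φ) (hn : k + 2 ≤ n) {i m : Fin n} (him : i ≠ m)
    (a : ℕ → Fin n) (ha : ∀ p ≤ k, a p ≠ m) :
    Φ i (commWord a k) = ∑ p ∈ Finset.range (k + 1),
      if a p = i then Φ m (commWord (Function.update a p m) k) else 0 := by
  obtain ⟨P, hP, -, hP1⟩ := IsGradedChar.exists_polynomial_commWord i m k _ (h.char m) a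
  obtain ⟨Q, hQ, hQ0, -⟩ := IsGradedChar.exists_polynomial_commWord i m k _ (h.char i) a
  have hT : ∀ (c : ℤ) (j : Fin n), elemHom i 1 (FreeGroup.of m ^ c) (FreeGroup.of j) =
      if j = i then FreeGroup.of i * FreeGroup.of m ^ c else FreeGroup.of j := by
    intro c j
    split_ifs with hj
    · rw [hj, elemHom_of_self, one_mul]
    · exact elemHom_of_ne hj _ _
  have hm : m ∉ (Finset.range (k + 1)).image a := by
    simp only [Finset.mem_image, Finset.mem_range, not_exists, not_and]
    exact fun p hp => ha p (by omega)
  have hPQ : P = Q * Polynomial.X := by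
    refine Polynomial.eq_of_infinite_eval_eq _ _ (Set.Infinite.mono ?_
      (Set.infinite_range_of_injective (f := fun d : ℕ => ((2 * (d : ℤ) : ℤ) : ℝ)) ?_))
    · rintro _ ⟨d, rfl⟩
      have := h.apply_transvection hn him hm (Finset.card_image_le.trans (by simp))
        (commWord_mem_freeSub a k) (commWord_mem_lcs a k) d
      rw [hP _ _ (hT _), hQ _ _ (hT _)] at this
      rw [Set.mem_ofPred_eq, Polynomial.eval_mul, Polynomial.eval_X, this, mul_comm]
    · intro d e hde
      have : (2 * (d : ℤ) : ℤ) = 2 * (e : ℤ) := Int.cast_injective (α := ℝ) hde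
      omega
  rw [← hQ0, ← hP1, hPQ, Polynomial.coeff_mul_X]

end VanishesOnOrbits

/-! ### Generators and relations modulo the orbits -/

theorem exists_notMem_finset {n : ℕ} (A : Finset (Fin n)) (h : A.card < n) : ∃ m, m ∉ A := by
  by_contra hall
  push Not at hall
  have := Finset.card_le_card (fun x _ => hall x : (Finset.univ : Finset (Fin n)) ⊆ A)
  rw [Finset.card_univ, Fintype.card_fin] at this
  omega

/-- To leading order, `[…[g, a₀], …, a_{q-1}]` is additive in `g`. -/
theorem leftComm_mul {G : Type*} [Group G] (g : G) {p : ℕ} {u : G} (hu : u ∈ lcs G p) (a : ℕ → G)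
    (q : ℕ) : ∃ e ∈ lcs G (p + q), leftComm (g * u) a q = leftComm g a q * e ∧
      ((leftComm u a q : G) : G ⧸ lcs G (p + q + 1)) = e := by
  induction q with
  | zero => exact ⟨u, hu, rfl, rfl⟩
  | succ q ih =>
    obtain ⟨e, he, h1, h2⟩ := ih
    set z := leftComm g a q with hz
    set c := a q with hc
    have hec := commutator_mem_lcs_succ he c
    refine ⟨(⁅z, c⁆⁻¹ * z) * ⁅e, c⁆ * (⁅z, c⁆⁻¹ * z)⁻¹, lcs_conj_mem hec _, ?_, ?_⟩
    · rw [leftComm, leftComm, h1, ← hz, ← hc]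
      simp only [commutatorElement_def]
      group
    · have hconj : ((⁅z, c⁆⁻¹ * z * ⁅e, c⁆ * (⁅z, c⁆⁻¹ * z)⁻¹ : G) : G ⧸ lcs G (p + (q + 1) + 1)) =
          (⁅e, c⁆ : G) := mk_conj_of_mem_lcs hec _
      rw [hconj, leftComm]
      set w := leftComm u a q with hw
      have hwm : w ∈ lcs G (p + q) := leftComm_mem_lcs hu a q
      have hd : w⁻¹ * e ∈ lcs G (p + q + 1) := QuotientGroup.eq.mp h2
      have e1 : ⁅e, c⁆ = w * ⁅w⁻¹ * e, c⁆ * w⁻¹ * ⁅w, c⁆ := by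
        simp only [commutatorElement_def]; group
      have h3 : ((w * ⁅w⁻¹ * e, c⁆ * w⁻¹ : G) : G ⧸ lcs G (p + (q + 1) + 1)) = 1 :=
        (QuotientGroup.eq_one_iff _).mpr (lcs_conj_mem (commutator_mem_lcs_succ hd c) w)
      rw [e1, QuotientGroup.mk_mul, h3, one_mul]

/-- If `r` acts trivially on the abelianization, then `x⁻¹ r⁻¹(s(x))` and `r(x)⁻¹ s(x)` agree to
leading order. -/
theorem inv_mul_comp_apply {G : Type*} [Group G] {k : ℕ} {r s : MulAut G} (hr : r ∈ johnson G 1)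
    {x : G} (h : (r x)⁻¹ * s x ∈ lcs G k) :
    x⁻¹ * (r⁻¹ * s) x ∈ lcs G k ∧
      (((r x)⁻¹ * s x : G) : G ⧸ lcs G (k + 1)) = (x⁻¹ * (r⁻¹ * s) x : G) := by
  have e : x⁻¹ * (r⁻¹ * s) x = r⁻¹ ((r x)⁻¹ * s x) := by
    rw [map_mul, map_inv, MulAut.inv_apply_self, MulAut.mul_apply]
  rw [e]
  exact ⟨map_mem_lcs (r⁻¹).toMonoidHom h, (mk_apply_eq_of_mem_johnson_one (inv_mem hr) k h).symm⟩

namespace VanishesOnOrbits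

variable {n k : ℕ} {Φ : Fin n → FreeGroup (Fin n) → ℝ}

/-- Modulo the orbits, `x_l^* ⊗ [x_l, x_{a₀}, …, x_{a_{k-1}}]` does not depend on `l`, as long as
`x_l` does not occur among the `x_{a_p}`. -/
theorem apply_leftComm_eq (h : VanishesOnOrbits k Φ) (hn : k + 2 ≤ n) {l m : Fin n} (hlm : l ≠ m)
    (a : ℕ → Fin n) (hl : ∀ p < k, a p ≠ l) (hm : ∀ p < k, a p ≠ m) :
    Φ l (leftComm (FreeGroup.of l) (fun p => FreeGroup.of (a p)) k) =
      Φ m (leftComm (FreeGroup.of m) (fun p => FreeGroup.of (a p)) k) := by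
  have := h.apply_commWord hn hlm (fun p => Nat.casesOn p l a) (fun p hp => by
    cases p with
    | zero => exact hlm
    | succ p => exact hm p hp)
  refine this.trans ?_
  rw [Finset.sum_eq_single 0]
  · refine (if_pos rfl).trans ?_
    rw [commWord, Function.update_self]
    rfl
  · intro p hp hp0
    obtain ⟨p, rfl⟩ := Nat.exists_eq_succ_of_ne_zero hp0
    exact if_neg (hl p (by simpa using hp))
  · simp

/-- Modulo the orbits, `x_l^* ⊗ [x_l, x_{a₀}, …, x_{a_{k-1}}]` is invariant under cyclic rotations
of the word `a`. This comes from the commutator of the automorphisms `x_l ↦ x_l [x_m, x_{a₀}]` and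
`x_m ↦ x_m [x_l, x_{a₁}, …, x_{a_{k-1}}]`. -/
theorem apply_leftComm_rotate (h : VanishesOnOrbits k Φ) (hn : k + 2 ≤ n) (hk : 2 ≤ k)
    {l m : Fin n} (hlm : l ≠ m) (a : ℕ → Fin n) (hl : ∀ p < k, a p ≠ l) (hm : ∀ p < k, a p ≠ m)
    (hcyc : a k = a 0) :
    Φ m (leftComm (FreeGroup.of m) (fun p => FreeGroup.of (a p)) k) =
      Φ l (leftComm (FreeGroup.of l) (fun p => FreeGroup.of (a (p + 1))) k) := by
  obtain ⟨j, rfl⟩ : ∃ j, k = j + 2 := ⟨k - 2, by omega⟩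
  set A := (Finset.range (j + 2)).image a with hA
  have haA : ∀ p < j + 2, a p ∈ A := fun p hp => Finset.mem_image_of_mem a (by simpa using hp)
  have hlA : l ∉ A := by
    simp only [hA, Finset.mem_image, Finset.mem_range, not_exists, not_and]; exact hl
  have hmA : m ∉ A := by
    simp only [hA, Finset.mem_image, Finset.mem_range, not_exists, not_and]; exact hm
  have hAc : A.card ≤ j + 2 := Finset.card_image_le.trans (by simp)
  set x := FreeGroup.of l with hx
  set y := FreeGroup.of m with hy
  set c := FreeGroup.of (a 0) with hc
  set b : ℕ → FreeGroup (Fin n) := fun p => FreeGroup.of (a (p + 1)) with hb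
  have hlJ : l ∉ insert m A := by simp [hlm, hlA]
  have hmJ : m ∉ insert l A := by simp [hlm.symm, hmA]
  have hu : ⁅y, c⁆ ∈ freeSub (insert m A) :=
    leftComm_mem (a := fun _ => c) (q := 1) _ (of_mem_freeSub (Finset.mem_insert_self _ _))
      fun _ _ => of_mem_freeSub (Finset.mem_insert_of_mem (haA 0 (by omega)))
  have hv : leftComm x b (j + 1) ∈ freeSub (insert l A) :=
    leftComm_mem _ (of_mem_freeSub (Finset.mem_insert_self _ _)) fun p hp =>
      of_mem_freeSub (Finset.mem_insert_of_mem (haA _ (by omega)))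
  set f := elemAut l 1 ⁅y, c⁆ hlJ (one_mem _) hu with hf
  set g := elemAut m 1 (leftComm x b (j + 1)) hmJ (one_mem _) hv with hg
  have hfx : f x = x * ⁅y, c⁆ := by rw [hf, hx, elemAut_of_self, one_mul]
  have hgy : g y = y * leftComm x b (j + 1) := by rw [hg, hy, elemAut_of_self, one_mul]
  have hf_ne : ∀ i, i ≠ l → f (FreeGroup.of i) = FreeGroup.of i := fun i hi =>
    elemAut_of_ne _ _ _ hi
  have hg_ne : ∀ i, i ≠ m → g (FreeGroup.of i) = FreeGroup.of i := fun i hi =>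
    elemAut_of_ne _ _ _ hi
  have hfy : f y = y := hf_ne m hlm.symm
  have hgx : g x = x := hg_ne l hlm
  have hgc : g c = c := hg_ne (a 0) (hm 0 (by omega))
  have hf1 : f ∈ johnson (FreeGroup (Fin n)) 1 :=
    elemAut_mem_johnson hlJ hu (commutator_mem_lcs_succ (q := 0) (Subgroup.mem_top y) c)
  have hg1 : g ∈ johnson (FreeGroup (Fin n)) 1 :=
    elemAut_mem_johnson hmJ hv (Subgroup.lowerCentralSeries_antitone (⊤ : Subgroup _)
      (by omega : 1 ≤ j + 1) (leftComm_mem_lcs_self _ _ _))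
  have hr1 : g * f ∈ johnson (FreeGroup (Fin n)) 1 := mul_mem hg1 hf1
  -- the commutator of `f` and `g` on `x_l`
  have hxval : ((g * f) x)⁻¹ * (f * g) x =
      ⁅y, c⁆⁻¹ * (y * ⁅leftComm x b (j + 1), c⁆⁻¹ * y⁻¹) * ⁅y, c⁆⁻¹⁻¹ := by
    rw [MulAut.mul_apply, MulAut.mul_apply, hgx, hfx, map_mul, hgx, map_commutatorElement, hgy,
      hgc]
    simp only [commutatorElement_def]
    group
  have hVc : ⁅leftComm x b (j + 1), c⁆ = leftComm x b (j + 2) := by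
    change _ = ⁅leftComm x b (j + 1), FreeGroup.of (a (j + 2))⁆
    rw [hcyc]
  have hVm : leftComm x b (j + 2) ∈ lcs (FreeGroup (Fin n)) (j + 2) := leftComm_mem_lcs_self _ _ _
  have hxmem : ((g * f) x)⁻¹ * (f * g) x ∈ lcs (FreeGroup (Fin n)) (j + 2) := by
    rw [hxval, hVc]
    exact lcs_conj_mem (lcs_conj_mem (inv_mem hVm) _) _
  have hxΦ : Φ l (((g * f) x)⁻¹ * (f * g) x) = -Φ l (leftComm x b (j + 2)) := by
    rw [hxval, hVc, (h.char l).map_conj (lcs_conj_mem (inv_mem hVm) _),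
      (h.char l).map_conj (inv_mem hVm), (h.char l).map_inv hVm]
  -- the commutator of `f` and `g` on `x_m`
  obtain ⟨e, he, he1, he2⟩ := leftComm_mul x
    (commutator_mem_lcs_succ (q := 0) (Subgroup.mem_top y) c) b (j + 1)
  have hyval : ((g * f) y)⁻¹ * (f * g) y = e := by
    have hfv : f (leftComm x b (j + 1)) = leftComm (x * ⁅y, c⁆) b (j + 1) := by
      have := map_leftComm f.toMonoidHom x b (j + 1)
      refine this.trans ?_
      change leftComm (f x) _ _ = _
      rw [hfx]
      exact leftComm_congr _ fun p hp => hf_ne _ (hl _ (by omega))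
    rw [MulAut.mul_apply, MulAut.mul_apply, hfy, hgy, map_mul, hfy, hfv,
      he1]
    group
  rw [show 0 + 1 + (j + 1) = j + 2 by omega] at he he2
  have hyΦ : Φ m (((g * f) y)⁻¹ * (f * g) y) =
      Φ m (leftComm y (fun p => FreeGroup.of (a p)) (j + 2)) := by
    rw [hyval, leftComm_succ']
    refine (h.char m).congr_mk ?_ he2
    have := leftComm_mem_lcs (commutator_mem_lcs_succ (q := 0) (Subgroup.mem_top y) c) b (j + 1)
    rwa [show 0 + 1 + (j + 1) = j + 2 by omega] at this
  have hother : ∀ i, i ≠ l → i ≠ m →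
      ((g * f) (FreeGroup.of i))⁻¹ * (f * g) (FreeGroup.of i) = 1 := by
    intro i hil him
    rw [MulAut.mul_apply, MulAut.mul_apply, hf_ne i hil, hg_ne i him, hf_ne i hil, inv_mul_cancel]
  have hmem : ∀ i, ((g * f) (FreeGroup.of i))⁻¹ * (f * g) (FreeGroup.of i) ∈
      lcs (FreeGroup (Fin n)) (j + 2) := by
    intro i
    rcases eq_or_ne i l with rfl | hil
    · exact hxmem
    · rcases eq_or_ne i m with rfl | him
      · rw [hyval]; exact he
      · rw [hother i hil him]; exact one_mem _
  have hJ : (g * f)⁻¹ * (f * g) ∈ johnson (FreeGroup (Fin n)) (j + 2) :=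
    mem_johnson_of_generators fun i => (inv_mul_comp_apply hr1 (hmem i)).1
  have hfI : f ∈ (autNGroup n).sub (insert l (insert m A)) :=
    elemAut_mem_sub _ _ _ (by simp) (Finset.subset_insert _ _)
  have hgI : g ∈ (autNGroup n).sub (insert l (insert m A)) :=
    elemAut_mem_sub _ _ _ (by simp) (Finset.insert_subset_insert _ (Finset.subset_insert _ _))
  have h0 := h.pairing_eq_zero hn
    ((Finset.card_insert_le _ _).trans (Nat.succ_le_succ ((Finset.card_insert_le _ _).trans
      (Nat.succ_le_succ hAc)))) hJ
    (mul_mem (inv_mem (mul_mem hgI hfI)) (mul_mem hfI hgI))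
  have h1 : johnsonPairing Φ ((g * f)⁻¹ * (f * g)) =
      ∑ i, Φ i (((g * f) (FreeGroup.of i))⁻¹ * (f * g) (FreeGroup.of i)) :=
    Finset.sum_congr rfl fun i _ =>
      (h.char i).congr_mk (hmem i) (inv_mul_comp_apply hr1 (hmem i)).2
  rw [h1, Fintype.sum_eq_add l m hlm] at h0
  · rw [← hx, ← hy, hxΦ, hyΦ] at h0
    linarith
  · rintro i ⟨hil, him⟩
    rw [hother i hil him, (h.char i).map_one]

/-- In degree `1`, the elements `x_l^* ⊗ [x_l, x_{a₀}]` come from conjugations of one generator by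
another one. -/
theorem apply_leftComm_one (h : VanishesOnOrbits 1 Φ) (hn : 3 ≤ n) {l : Fin n}
    (a : ℕ → Fin n) (hl : a 0 ≠ l) :
    Φ l (leftComm (FreeGroup.of l) (fun p => FreeGroup.of (a p)) 1) = 0 := by
  set x := FreeGroup.of l with hx
  set c := FreeGroup.of (a 0) with hc
  have hlJ : l ∉ ({a 0} : Finset (Fin n)) := by simpa using hl.symm
  have hcJ : c ∈ freeSub {a 0} := of_mem_freeSub (by simp)
  set f := elemAut l c c⁻¹ hlJ hcJ (inv_mem hcJ) with hf
  have hf_ne : ∀ i, i ≠ l → f (FreeGroup.of i) = FreeGroup.of i := fun i hi =>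
    elemAut_of_ne _ _ _ hi
  have hfx : x⁻¹ * f x = x⁻¹ * ⁅x, c⁆⁻¹ * x⁻¹⁻¹ := by
    rw [hf, hx, elemAut_of_self]
    simp only [commutatorElement_def]
    group
  have hm : ⁅x, c⁆ ∈ lcs (FreeGroup (Fin n)) 1 :=
    commutator_mem_lcs_succ (q := 0) (Subgroup.mem_top x) c
  have hfJ : f ∈ johnson (FreeGroup (Fin n)) 1 := mem_johnson_of_generators fun i => by
    rcases eq_or_ne i l with rfl | hi
    · rw [← hx, hfx]; exact lcs_conj_mem (inv_mem hm) _
    · rw [hf_ne i hi, inv_mul_cancel]; exact one_mem _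
  have h0 := h.pairing_eq_zero hn ((Finset.card_insert_le l {a 0}).trans (by simp)) hfJ
    (elemAut_mem_sub _ _ _ (Finset.mem_insert_self _ _) (Finset.subset_insert _ _))
  rw [johnsonPairing, Finset.sum_eq_single l] at h0
  · rw [← hx, hfx, (h.char l).map_conj (inv_mem hm), (h.char l).map_inv hm, neg_eq_zero] at h0
    exact h0
  · intro i _ hi
    rw [hf_ne i hi, inv_mul_cancel, (h.char i).map_one]
  · exact fun hi => absurd (Finset.mem_univ l) hi

/-- Modulo the orbits, `Hom(F^{ab}, lcs F k / lcs F (k + 1))` is spanned by the elements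
`x_m^* ⊗ [x_m, x_{a₀}, …, x_{a_{k-1}}]`, where `x_m` is none of the `x_{a_p}`. -/
theorem eq_zero_of_leftComm (h : VanishesOnOrbits k Φ) (hn : k + 2 ≤ n)
    (h0 : ∀ (m : Fin n) (a : ℕ → Fin n), (∀ p < k, a p ≠ m) →
      Φ m (leftComm (FreeGroup.of m) (fun p => FreeGroup.of (a p)) k) = 0)
    (i : Fin n) {w : FreeGroup (Fin n)} (hw : w ∈ lcs (FreeGroup (Fin n)) k) : Φ i w = 0 := by
  refine (h.char i).eq_zero_of_commWord (fun a => ?_) hw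
  set A := (Finset.range (k + 1)).image a
  have hAc : A.card ≤ k + 1 := Finset.card_image_le.trans (by simp)
  by_cases hi : i ∈ A
  · obtain ⟨m, hm⟩ := exists_notMem_finset A (hAc.trans_lt (by omega))
    have ham : ∀ p ≤ k, a p ≠ m := fun p hp hpm =>
      hm (hpm ▸ Finset.mem_image_of_mem a (Finset.mem_range.mpr (by omega)))
    rw [h.apply_commWord hn (fun him : i = m => hm (him ▸ hi)) a ham]
    refine Finset.sum_eq_zero fun p hp => ?_
    split_ifs
    · refine (h.char m).commWord_eq_zero_of_occurs_once m k _ (h0 m) _ p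
        (by simpa [Nat.lt_succ_iff] using hp) (Function.update_self _ _ _) fun p' hp' hne => ?_
      rw [Function.update_of_ne hne]
      exact ham p' hp'
    · rfl
  · exact h.apply_eq_zero hn hi hAc (commWord_mem_freeSub a k) (commWord_mem_lcs a k)

end VanishesOnOrbits

/-! ### The functional is a divergence -/

namespace VanishesOnOrbits

variable {n k : ℕ} {Φ : Fin n → FreeGroup (Fin n) → ℝ}

/-- In degree at least `2`, a functional vanishing on the orbits takes on the elements
`x_l^* ⊗ [x_l, x_{b₀}, …, x_{b_{k-1}}]` values that depend on the cyclic word `b` only. -/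
theorem exists_cyclic_function [NeZero k] (h : VanishesOnOrbits k Φ) (hn : k + 2 ≤ n)
    (hk : 2 ≤ k) : ∃ ψ : (ZMod k → Fin n) → ℝ,
      (∀ (l : Fin n) (b : ZMod k → Fin n), (∀ p, b p ≠ l) →
        Φ l (leftComm (FreeGroup.of l) (fun p => FreeGroup.of (b p)) k) = ψ b) ∧
      ∀ (s : ZMod k) (b : ZMod k → Fin n), ψ (fun p => b (p + s)) = ψ b := by
  have hcard : ∀ b : ZMod k → Fin n, (Finset.univ.image b).card ≤ k := fun b =>
    Finset.card_image_le.trans (by rw [Finset.card_univ, ZMod.card])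
  have hne : ∀ {b : ZMod k → Fin n} {l : Fin n} {A : Finset (Fin n)}, Finset.univ.image b ⊆ A →
      l ∉ A → ∀ p, b p ≠ l := fun hA hl p hp =>
    hl (hA (hp ▸ Finset.mem_image_of_mem _ (Finset.mem_univ p)))
  have hfresh : ∀ b : ZMod k → Fin n, ∃ l, ∀ p, b p ≠ l := fun b => by
    obtain ⟨l, hl⟩ := exists_notMem_finset (Finset.univ.image b) ((hcard b).trans_lt (by omega))
    exact ⟨l, hne subset_rfl hl⟩
  -- `L b` is the index of a generator that does not occur in `b`
  choose L hL using hfresh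
  have hψ : ∀ (l : Fin n) (b : ZMod k → Fin n), (∀ p, b p ≠ l) →
      Φ l (leftComm (FreeGroup.of l) (fun p => FreeGroup.of (b p)) k) =
        Φ (L b) (leftComm (FreeGroup.of (L b)) (fun p => FreeGroup.of (b p)) k) := by
    intro l b hl
    rcases eq_or_ne l (L b) with hlL | hlL
    · rw [← hlL]
    · exact h.apply_leftComm_eq hn hlL (fun p => b p) (fun p _ => hl p) fun p _ => hL b p
  refine ⟨_, hψ, ?_⟩
  have hone : ∀ b : ZMod k → Fin n,
      Φ (L fun p => b (p + 1)) (leftComm (FreeGroup.of (L fun p => b (p + 1)))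
        (fun p => FreeGroup.of (b (p + 1))) k) =
      Φ (L b) (leftComm (FreeGroup.of (L b)) (fun p => FreeGroup.of (b p)) k) := by
    intro b
    obtain ⟨l, hl⟩ := exists_notMem_finset (Finset.univ.image b) ((hcard b).trans_lt (by omega))
    obtain ⟨m, hm⟩ := exists_notMem_finset (insert l (Finset.univ.image b))
      ((Finset.card_insert_le _ _).trans_lt (by have := hcard b; omega))
    have hbl := hne subset_rfl hl
    have hbm := hne (Finset.subset_insert _ _) hm
    have hlm : l ≠ m := fun hlm => hm (hlm ▸ Finset.mem_insert_self _ _)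
    rw [← hψ m b hbm, ← hψ l (fun p => b (p + 1)) fun p => hbl _]
    have := h.apply_leftComm_rotate hn hk hlm (fun p => b p) (fun p _ => hbl p) (fun p _ => hbm p)
      (by simp)
    rw [this]
    simp
  intro s b
  have hnat : ∀ (s : ℕ) (b : ZMod k → Fin n),
      Φ (L fun p => b (p + s)) (leftComm (FreeGroup.of (L fun p => b (p + s)))
        (fun p => FreeGroup.of (b (p + s))) k) =
      Φ (L b) (leftComm (FreeGroup.of (L b)) (fun p => FreeGroup.of (b p)) k) := by
    intro s
    induction s with
    | zero => intro b; simp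
    | succ s ih =>
      intro b
      rw [← ih b, ← hone fun p => b (p + s)]
      simp only [Nat.cast_add, Nat.cast_one, add_right_comm, add_assoc]
  have := hnat s.val b
  rwa [ZMod.natCast_zmod_val] at this

/-- The central step: a functional that vanishes on the orbits vanishes on the image of the
Johnson homomorphism. -/
theorem pairing_eq_zero_of_mem_johnson (h : VanishesOnOrbits k Φ) (hn : k + 2 ≤ n) (hk : 1 ≤ k)
    {f : MulAut (FreeGroup (Fin n))} (hf : f ∈ johnson (FreeGroup (Fin n)) k) :
    johnsonPairing Φ f = 0 := by
  have hfk : ∀ f ∈ johnson (FreeGroup (Fin n)) k, ∀ i,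
      (FreeGroup.of i)⁻¹ * f (FreeGroup.of i) ∈ lcs (FreeGroup (Fin n)) k :=
    fun f hf i => mem_johnson_iff.mp hf _
  rcases hk.eq_or_lt with rfl | hk2
  · exact Finset.sum_eq_zero fun i _ => h.eq_zero_of_leftComm hn
      (fun m a ha => h.apply_leftComm_one hn a (ha 0 one_pos)) i (hfk f hf i)
  have : NeZero k := ⟨by omega⟩
  obtain ⟨ψ, hψ, hrot⟩ := h.exists_cyclic_function hn hk2
  choose lam hlam_char hlam_zero hlam using
    fun b : ZMod k → Fin n => exists_divergence (α := Fin n) hk2 b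
  -- `Λ` is the divergence that agrees with `Φ` on all `x_l^* ⊗ [x_l, x_{a₀}, …, x_{a_{k-1}}]`; the
  -- factor `1 / k` accounts for the `k` rotations of a cyclic word
  let Λ : Fin n → FreeGroup (Fin n) → ℝ := fun i w =>
    ∑ b : ZMod k → Fin n, ((-1) ^ k / k * ψ b) * lam b i w
  have hΛchar : ∀ i, IsGradedChar k (Λ i) := fun i =>
    IsGradedChar.sum _ fun b => (hlam_char b i).const_mul _
  have hΛzero : ∀ f ∈ johnson (FreeGroup (Fin n)) k, johnsonPairing Λ f = 0 := by
    intro f hf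
    rw [johnsonPairing, Finset.sum_comm]
    refine Finset.sum_eq_zero fun b _ => ?_
    rw [← Finset.mul_sum, hlam_zero b f (hfk f hf), mul_zero]
  let Θ : Fin n → FreeGroup (Fin n) → ℝ := fun i w => Φ i w + -1 * Λ i w
  have hΘpair : ∀ f ∈ johnson (FreeGroup (Fin n)) k,
      johnsonPairing Θ f = johnsonPairing Φ f := by
    intro f hf
    have h1 : johnsonPairing Θ f = johnsonPairing Φ f + -1 * johnsonPairing Λ f := by
      rw [johnsonPairing, johnsonPairing, johnsonPairing, Finset.mul_sum,
        ← Finset.sum_add_distrib]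
    rw [h1, hΛzero f hf, mul_zero, add_zero]
  have hΘ : VanishesOnOrbits k Θ :=
    { char := fun i => (h.char i).add ((hΛchar i).const_mul (-1))
      pairing := fun γ hγ I hI f hf hfI => by
        rw [hΘpair _ ((johnson_normal _ k).conj_mem f hf γ)]
        exact h.pairing γ hγ I hI f hf hfI }
  rw [← hΘpair f hf]
  refine Finset.sum_eq_zero fun i _ => hΘ.eq_zero_of_leftComm hn (fun m a ha => ?_) i (hfk f hf i)
  -- the first `k` letters of `a`, arranged cyclically
  let b : ZMod k → Fin n := fun p => a p.val
  have hb : ∀ p < k, b (p : ZMod k) = a p := fun p hp => by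
    simp only [b, ZMod.val_cast_of_lt hp]
  have hbm : ∀ p, b p ≠ m := fun p => ha _ (ZMod.val_lt p)
  have hΦb := hψ m b hbm
  rw [leftComm_congr (b := fun p => FreeGroup.of (a p)) _ fun p hp => by rw [hb p hp]] at hΦb
  have hiff : ∀ (b' : ZMod k → Fin n) (s : ZMod k),
      (∀ p < k, b' (s + (p : ZMod k)) = a p) ↔ b' = fun p => b (p + -s) := by
    intro b' s
    constructor
    · intro hp
      funext z
      have := hp (z + -s).val (ZMod.val_lt _)
      rwa [ZMod.natCast_zmod_val, show s + (z + -s) = z by ring] at this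
    · rintro rfl p hp
      rw [← hb p hp]
      change b (s + p + -s) = b p
      rw [add_neg_cancel_comm]
  have hΛb : Λ m (leftComm (FreeGroup.of m) (fun p => FreeGroup.of (a p)) k) = ψ b := by
    have hk0 : (k : ℝ) ≠ 0 := Nat.cast_ne_zero.mpr (by omega)
    have hsign : ((-1 : ℝ) ^ k) * (-1) ^ k = 1 := by rw [← mul_pow]; simp
    calc Λ m (leftComm (FreeGroup.of m) (fun p => FreeGroup.of (a p)) k)
        = ∑ b' : ZMod k → Fin n, ∑ s : ZMod k,
            (1 / k : ℝ) * if b' = fun p => b (p + -s) then ψ b' else 0 := by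
          refine Finset.sum_congr rfl fun b' _ => ?_
          rw [hlam b' m a ha, Finset.mul_sum, Finset.mul_sum]
          refine Finset.sum_congr rfl fun s _ => ?_
          simp only [hiff]
          split_ifs
          · rw [mul_one, div_mul_eq_mul_div, div_mul_eq_mul_div, mul_right_comm, hsign, one_mul,
              one_div, div_eq_inv_mul]
          · simp
      _ = ∑ s : ZMod k, (1 / k : ℝ) * ψ b := by
          rw [Finset.sum_comm]
          refine Finset.sum_congr rfl fun s _ => ?_
          rw [← Finset.mul_sum, Finset.sum_ite_eq' Finset.univ (fun p => b (p + -s)) ψ,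
            if_pos (Finset.mem_univ _), hrot]
      _ = ψ b := by
          rw [Finset.sum_const, Finset.card_univ, ZMod.card, nsmul_eq_mul]
          field_simp
  change Φ m _ + -1 * Λ m _ = 0
  rw [hΦb, hΛb]
  ring

end VanishesOnOrbits

/-! ### Extending functionals along the Johnson homomorphism -/

/-- The center of `F / lcs F (k + 1)`, which contains `lcs F k / lcs F (k + 1)`. -/
abbrev lcsCenter (α : Type*) (k : ℕ) : Subgroup (FreeGroup α ⧸ lcs (FreeGroup α) (k + 1)) :=
  Subgroup.center _

instance lcsCenter.instCommGroup (α : Type*) (k : ℕ) : CommGroup (lcsCenter α k) :=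
  { (inferInstance : Group (lcsCenter α k)) with
    mul_comm := fun a b => Subtype.ext (Subgroup.mem_center_iff.mp b.2 a) }

theorem mk_mem_lcsCenter {α : Type*} {k : ℕ} {w : FreeGroup α} (hw : w ∈ lcs (FreeGroup α) k) :
    (w : FreeGroup α ⧸ lcs (FreeGroup α) (k + 1)) ∈ lcsCenter α k :=
  Subgroup.mem_center_iff.mpr fun y => by
    induction y using QuotientGroup.induction_on with
    | H y => exact (mk_lcs_commute hw y).symm.eq

/-- The Johnson homomorphism `f ↦ (x⁻¹ f(x))_x` modulo `lcs F (k + 1)`, with values in the center of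
`F / lcs F (k + 1)`. -/
def johnsonHom (α : Type*) (k : ℕ) (hk : 1 ≤ k) :
    johnson (FreeGroup α) k →*
      (α → lcsCenter α k) where
  toFun f i := ⟨((FreeGroup.of i)⁻¹ * f.1 (FreeGroup.of i) : FreeGroup α),
    mk_mem_lcsCenter (mem_johnson_iff.mp f.2 _)⟩
  map_one' := by
    funext i
    refine Subtype.ext ?_
    change (((FreeGroup.of i)⁻¹ * FreeGroup.of i : FreeGroup α) :
      FreeGroup α ⧸ lcs (FreeGroup α) (k + 1)) = 1
    rw [inv_mul_cancel]; rfl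
  map_mul' f g := by
    funext i
    refine Subtype.ext ?_
    have h1 := mk_apply_eq_of_mem_johnson_one (johnson_anti hk f.2) k
      (mem_johnson_iff.mp g.2 (FreeGroup.of i))
    change QuotientGroup.mk' (lcs (FreeGroup α) (k + 1))
        ((FreeGroup.of i)⁻¹ * f.1 (g.1 (FreeGroup.of i))) =
      QuotientGroup.mk' (lcs (FreeGroup α) (k + 1)) ((FreeGroup.of i)⁻¹ * f.1 (FreeGroup.of i)) *
        ((((FreeGroup.of i)⁻¹ * g.1 (FreeGroup.of i) : FreeGroup α)) :
          FreeGroup α ⧸ lcs (FreeGroup α) (k + 1))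
    rw [← h1, ← QuotientGroup.mk'_apply, ← map_mul, map_mul f.1, map_inv]
    congr 1
    group

theorem johnsonHom_ker {α : Type*} {k : ℕ} (hk : 1 ≤ k) :
    (johnsonHom α k hk).ker =
      (johnson (FreeGroup α) (k + 1)).subgroupOf (johnson (FreeGroup α) k) := by
  ext f
  rw [MonoidHom.mem_ker, Subgroup.mem_subgroupOf]
  constructor
  · intro h
    refine mem_johnson_of_generators fun i => ?_
    have := congrArg Subtype.val (congrFun h i)
    exact (QuotientGroup.eq_one_iff _).mp this
  · intro h
    funext i
    exact Subtype.ext ((QuotientGroup.eq_one_iff _).mpr (mem_johnson_iff.mp h _))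

theorem exists_extension_real {A B : Type*} [CommGroup A] [CommGroup B] (τ : A →* B)
    (hτ : Function.Injective τ) (ξ : Additive A →+ ℝ) :
    ∃ Ψ : Additive B →+ ℝ, ∀ a, Ψ (Additive.ofMul (τ a)) = ξ (Additive.ofMul a) := by
  obtain ⟨Ψ, hΨ⟩ := (Module.Baer.of_divisible ℝ).extension_property_addMonoidHom
    (MonoidHom.toAdditive τ) hτ ξ
  exact ⟨Ψ, fun a => DFunLike.congr_fun hΨ (Additive.ofMul a)⟩

/-- Every homomorphism from `johnson F k / johnson F (k + 1)` to `ℝ` is the pairing with a family of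
characters of degree `k`, because the Johnson homomorphism is injective and `ℝ` is divisible. -/
theorem exists_johnsonPairing_eq {n : ℕ} (k : ℕ+)
    (ξ : Additive (JohnsonQuotient (FreeGroup (Fin n)) k) →+ ℝ) :
    ∃ Φ : Fin n → FreeGroup (Fin n) → ℝ, (∀ i, IsGradedChar k (Φ i)) ∧
      ∀ f : johnson (FreeGroup (Fin n)) k,
        ξ (Additive.ofMul (QuotientGroup.mk f)) = johnsonPairing Φ f.1 := by
  classical
  have hker := johnsonHom_ker (α := Fin n) k.pos
  let τ : JohnsonQuotient (FreeGroup (Fin n)) k →* (Fin n → lcsCenter (Fin n) k) :=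
    QuotientGroup.lift _ (johnsonHom (Fin n) k k.pos) fun x hx => by
      rwa [← hker, MonoidHom.mem_ker] at hx
  have hτ : Function.Injective τ := by
    rw [injective_iff_map_eq_one]
    intro q
    induction q using QuotientGroup.induction_on with
    | H f =>
      intro hf
      rw [QuotientGroup.eq_one_iff, ← hker]
      exact hf
  obtain ⟨Ψ, hΨ⟩ := exists_extension_real τ hτ ξ
  refine ⟨fun i w =>
    if hw : (w : FreeGroup (Fin n) ⧸ lcs (FreeGroup (Fin n)) ((k : ℕ) + 1)) ∈ lcsCenter (Fin n) k
    then Ψ (Additive.ofMul (Pi.mulSingle i ⟨_, hw⟩)) else 0,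
    fun i => ⟨fun u hu v hv => ?_, fun u hu => ?_⟩, fun f => ?_⟩
  · beta_reduce
    rw [dif_pos (mk_mem_lcsCenter (mul_mem hu hv)), dif_pos (mk_mem_lcsCenter hu),
      dif_pos (mk_mem_lcsCenter hv), ← map_add, ← ofMul_mul, ← Pi.mulSingle_mul]
    rfl
  · have h1 : (u : FreeGroup (Fin n) ⧸ lcs (FreeGroup (Fin n)) ((k : ℕ) + 1)) = 1 :=
      (QuotientGroup.eq_one_iff _).mpr hu
    simp only [h1]
    rw [dif_pos (one_mem _)]
    have : (⟨1, one_mem _⟩ : lcsCenter (Fin n) k) = 1 := rfl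
    rw [this, Pi.mulSingle_one, ofMul_one, map_zero]
  · have h1 : ξ (Additive.ofMul (QuotientGroup.mk f)) =
        Ψ (Additive.ofMul (johnsonHom (Fin n) k k.pos f)) :=
      (hΨ (QuotientGroup.mk f)).symm
    rw [h1, ← Finset.univ_prod_mulSingle (johnsonHom (Fin n) k k.pos f), ofMul_prod, map_sum]
    refine Finset.sum_congr rfl fun i _ => ?_
    beta_reduce
    rw [dif_pos (mk_mem_lcsCenter (mem_johnson_iff.mp f.2 _))]
    rfl

/-! ### The orbit generation degree -/

theorem mainTheorem8 (n : ℕ) (hn : 2 ≤ n) (k : ℕ+) :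
    (jlNVectorSpace n k).orbitDegree (jlRep n k) ≤ (((k : ℕ) + 2 : ℕ) : ℕ∞) := by
  rw [NVectorSpace.orbitDegree_le_iff]
  rcases Nat.lt_or_ge n ((k : ℕ) + 2) with hlt | hge
  · -- `JL(k)_I` is everything for `I = [n]`
    refine ⟨n, hlt.le, ?_⟩
    rw [NVectorSpace.OrbitGenerated, eq_top_iff]
    refine fun v _ => Submodule.subset_span ⟨1, Finset.univ, v, by simp, ?_, by simp⟩
    rw [(jlNVectorSpace n k).sub_univ]
    exact Submodule.mem_top
  · refine ⟨(k : ℕ) + 2, le_rfl, ?_⟩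
    rw [NVectorSpace.OrbitGenerated]
    by_contra hne
    obtain ⟨ξ, hξ0, hξ⟩ := Submodule.exists_le_ker_of_lt_top _ (lt_top_iff_ne_top.mpr hne)
    apply hξ0
    -- the functional `ξ` vanishes on all orbits, and it is the pairing with a family of characters
    obtain ⟨Φ, hΦ, hpair⟩ := exists_johnsonPairing_eq k
      (ξ.toAddMonoidHom.comp (TensorProduct.mk ℤ ℝ
        (Additive (JohnsonQuotient (FreeGroup (Fin n)) k)) 1).toAddMonoidHom)
    have hvan : VanishesOnOrbits k Φ := by
      refine ⟨hΦ, fun γ hγ I hI f hf hfI => ?_⟩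
      have hconj := (johnson_normal (FreeGroup (Fin n)) k).conj_mem f hf γ
      rw [← hpair ⟨γ * f * γ⁻¹, hconj⟩]
      refine hξ (Submodule.subset_span ⟨⟨γ, hγ⟩, I,
        1 ⊗ₜ Additive.ofMul (QuotientGroup.mk ⟨f, hf⟩), hI, ?_, ?_⟩)
      · exact Submodule.subset_span ⟨_, ⟨⟨f, hf⟩, hfI, rfl⟩, rfl⟩
      · rfl
    refine TensorProduct.AlgebraTensorModule.curry_injective ?_
    ext q
    obtain ⟨f, hf⟩ := QuotientGroup.mk_surjective (Additive.toMul q)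
    have h0 := hpair f
    rw [hvan.pairing_eq_zero_of_mem_johnson hge k.pos f.2, hf] at h0
    exact h0
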